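/- Let $n\ge 1$, $0<s<1$, let $\Omega\subset\mathbb R^n$ be a bounded Lipschitz domain (non-empty, open, connected) and $\Omega_e=\mathbb R^n\setminus\overline\Omega$. For $u:\mathbb R^n\to\mathbb R$ put $$\nabla^s u(x,y)=\sqrt{\tfrac{C_{n,s}}2}\,\frac{u(x)-u(y)}{|y-x|^{n/2+s+1}}\,(y-x),\qquad C_{n,s}=\frac{4^s\,\Gamma(n/2+s)}{\pi^{n/2}\,|\Gamma(-s)|}.$$ The fractional divergence of $U\in L^2(\mathbb R^{2n},\mathbb R^n)$ is the functional $\langle(\nabla\cdot)^sU,v\rangle=\int_{\mathbb R^{2n}}U\cdot\nabla^s v\,dx\,dy$, $v\in H^s(\mathbb R^n)$. For $A:\mathbb R^n\times\mathbb R^n\to\mathbb R^n$ let $A_s(x,y)=\frac12(A(x,y)+A(y,x))$ and $A_a=A-A_s$, and for a field $B$ let $B_{\|}(x,y)=\frac{B(x,y)\cdot(x-y)}{|x-y|^2}(x-y)$ if $x\ne y$, and $B_\|(x,x)=B(x,x)$. Assume that $A$ is Hölder continuous with exponent $s$ and has compact support in $\mathbb R^n\times\mathbb R^n$, that $A_{s\|}\in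 H^s(\mathbb R^{2n})$, that $$A_{a\|}(x,y)\cdot(y-x)\ge 0\quad\text{for all }x,y\in\mathbb R^n,$$ and that $$(\nabla\cdot)^sA_{s\|}+\int_{\mathbb R^n}|A(x,y)|^2\,dy\ \ge 0\quad\text{in }\Omega$$ in the sense of distributions, that is, tested against all $0\le\psi\in C_c^\infty(\Omega)$. Let $F\in L^\infty(\Omega)$ and $g\in L^\infty(\Omega_e)$ satisfy $F\ge0$ a.e. in $\Omega$ and $g\ge 0$ a.e. in $\Omega_e$. Let $u:\mathbb R^n\to\mathbb R$ be a weak solution of $$(-\Delta)^s_Au=F\ \text{ in }\Omega,\qquad u=g\ \text{ in }\Omega_e.$$ This means that $u$ is measurable, $u|_\Omega\in H^s(\Omega)$ (that is, $u|_\Omega$ is the restriction of an element of $H^s(\mathbb R^n)$), $\nabla^su$ is square integrable on $\{(x,y):x\in\Omega\text{ or }y\in\Omega\}$, $u=g$ a.e. in $\Omega_e$, and $$\int_{\mathbb R^{2n}}\bigl(\nabla^su(x,y)+A(x,y)u(x)\bigr)\cdot\bigl(\nabla^s\varphi(x,y)+A(x,y)\varphi(x)\bigr)\,dx\,dy=\int_\Omega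 F\varphi\,dx\quad\text{for all }\varphi\in C_c^\infty(\Omega).$$ (All these conditions of regularity hold if $u\in H^s(\mathbb R^n)$.) Then $u\ge0$ a.e. in $\mathbb R^n$. -/

import Mathlib

open MeasureTheory Set
open scoped ENNReal NNReal ContDiff RealInnerProductSpace

noncomputable section

namespace FMSE

/-- `ℝⁿ` with its Euclidean norm and Lebesgue measure. -/
abbrev Rn (n : ℕ) : Type := EuclideanSpace ℝ (Fin n)

/-! ### Domains -/

/-- A bounded Lipschitz domain: a bounded, open, connected, non-empty set which near each of its
boundary points is, after a rotation, the region strictly above the graph of a Lipschitz function.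
Here `e` is the unit vector of the vertical direction, `⟪e, x⟫` is the height of `x`, and
`x - ⟪e, x⟫ • e` is the orthogonal projection of `x` to the hyperplane orthogonal to `e`. -/
structure IsBoundedLipschitzDomain {n : ℕ} (Ω : Set (Rn n)) : Prop where
  isOpen : IsOpen Ω
  isConnected : IsConnected Ω
  isBounded : Bornology.IsBounded Ω
  lipschitz_boundary : ∀ x₀ ∈ frontier Ω, ∃ r : ℝ, 0 < r ∧ ∃ e : Rn n, ‖e‖ = 1 ∧
    ∃ (K : ℝ≥0) (γ : Rn n → ℝ), LipschitzWith K γ ∧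
      ∀ x ∈ Metric.ball x₀ r, (x ∈ Ω ↔ γ (x - ⟪e, x⟫ • e) < ⟪e, x⟫)

/-- The exterior `Ω_e = ℝⁿ \ closure Ω`. -/
def exterior {n : ℕ} (Ω : Set (Rn n)) : Set (Rn n) := (closure Ω)ᶜ

/-- `ψ ∈ C_c^∞(Ω)`. -/
structure IsTestFunction {n : ℕ} (Ω : Set (Rn n)) (ψ : Rn n → ℝ) : Prop where
  contDiff : ContDiff ℝ ∞ ψ
  hasCompactSupport : HasCompactSupport ψ
  tsupport_subset : tsupport ψ ⊆ Ω

/-! ### Sobolev spaces -/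

/-- `f ∈ H^s(X)` for a real-valued function `f` on a Euclidean space `X`: the function is square
integrable and the tempered distribution that it defines lies in the `L²`-based Sobolev space of
order `s`. -/
def MemHs {X : Type*} [NormedAddCommGroup X] [InnerProductSpace ℝ X] [FiniteDimensional ℝ X]
    [MeasurableSpace X] [BorelSpace X] (s : ℝ) (f : X → ℝ) : Prop :=
  ∃ hf : MemLp (fun x => (f x : ℂ)) 2 (volume : Measure X),
    TemperedDistribution.MemSobolev s 2 (MeasureTheory.Lp.toTemperedDistribution (hf.toLp _))

/-- `f|_Ω ∈ H^s(Ω)`, the space of restrictions to `Ω` of elements of `H^s(ℝⁿ)`. -/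
def MemHsOn {n : ℕ} (s : ℝ) (Ω : Set (Rn n)) (f : Rn n → ℝ) : Prop :=
  ∃ v : Rn n → ℝ, MemHs s v ∧ f =ᵐ[volume.restrict Ω] v

/-! ### Fractional gradient and divergence -/

/-- The constant `C_{n,s}` of the fractional Laplacian,
`C_{n,s} = 4^s Γ(n/2 + s) / (π^{n/2} |Γ(-s)|)`. -/
def fracConst (n : ℕ) (s : ℝ) : ℝ :=
  4 ^ s * Real.Gamma (n / 2 + s) / (Real.pi ^ ((n : ℝ) / 2) * |Real.Gamma (-s)|)

/-- The fractional gradient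
`∇^s u (x, y) = √(C_{n,s}/2) (u(x) - u(y)) / |y - x|^{n/2+s+1} (y - x)`. -/
def fracGrad {n : ℕ} (s : ℝ) (u : Rn n → ℝ) (z : Rn n × Rn n) : Rn n :=
  (Real.sqrt (fracConst n s / 2) *
    ((u z.1 - u z.2) / ‖z.2 - z.1‖ ^ ((n : ℝ) / 2 + s + 1))) • (z.2 - z.1)

/-- The fractional divergence `(∇·)^s U` of a vector field `U` on `ℝⁿ × ℝⁿ`, as a functional:
`⟨(∇·)^s U, v⟩ = ⟨U, ∇^s v⟩`. -/
def fracDiv {n : ℕ} (s : ℝ) (U : Rn n × Rn n → Rn n) (v : Rn n → ℝ) : ℝ :=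
  ∫ z : Rn n × Rn n, ⟪U z, fracGrad s v z⟫

/-! ### Magnetic potentials -/

/-- The symmetric part `A_s`. -/
def symPart {n : ℕ} (A : Rn n × Rn n → Rn n) (z : Rn n × Rn n) : Rn n :=
  (2 : ℝ)⁻¹ • (A z + A z.swap)

/-- The antisymmetric part `A_a`. -/
def antisymPart {n : ℕ} (A : Rn n × Rn n → Rn n) (z : Rn n × Rn n) : Rn n :=
  A z - symPart A z

open Classical in
/-- The parallel part `A_∥`. -/
def parPart {n : ℕ} (A : Rn n × Rn n → Rn n) (z : Rn n × Rn n) : Rn n :=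
  if z.1 = z.2 then A z else (⟪A z, z.1 - z.2⟫ / ‖z.1 - z.2‖ ^ 2) • (z.1 - z.2)

/-- `A ∈ C^s_c(ℝⁿ × ℝⁿ, ℝⁿ)`: Hölder continuous with exponent `s`, with compact support. -/
def MemHolderCompact {n : ℕ} (s : ℝ) (A : Rn n × Rn n → Rn n) : Prop :=
  (∃ C : ℝ≥0, HolderWith C s.toNNReal A) ∧ HasCompactSupport A

/-- `U ∈ H^s(ℝ^{2n})` for a vector field `U`, componentwise. The Euclidean space `ℝ^{2n}` is the
product `ℝⁿ × ℝⁿ` with its `ℓ²` norm. -/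
def MemHsDouble {n : ℕ} (s : ℝ) (U : Rn n × Rn n → Rn n) : Prop :=
  ∀ i : Fin n, MemHs s (fun z : WithLp 2 (Rn n × Rn n) => U z.ofLp i)

/-- `(∇·)^s A_{s∥} + ∫ |A(x,y)|² dy ≥ 0` in `Ω`, in the sense of distributions. -/
def EffectivePotentialNonneg {n : ℕ} (s : ℝ) (Ω : Set (Rn n)) (A : Rn n × Rn n → Rn n) : Prop :=
  ∀ ψ : Rn n → ℝ, IsTestFunction Ω ψ → (∀ x, 0 ≤ ψ x) →
    0 ≤ fracDiv s (parPart (symPart A)) ψ + ∫ x, (∫ y, ‖A (x, y)‖ ^ 2) * ψ x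

/-! ### Weak solutions -/

/-- The magnetic fractional gradient `∇^s_A u (x, y) = ∇^s u (x, y) + A(x, y) u(x)`. -/
def magGrad {n : ℕ} (s : ℝ) (A : Rn n × Rn n → Rn n) (u : Rn n → ℝ) (z : Rn n × Rn n) : Rn n :=
  fracGrad s u z + u z.1 • A z

/-- The form `⟨(-Δ)^s_A u, v⟩ = ⟨∇^s_A u, ∇^s_A v⟩`. -/
def magForm {n : ℕ} (s : ℝ) (A : Rn n × Rn n → Rn n) (u v : Rn n → ℝ) : ℝ :=
  ∫ z : Rn n × Rn n, ⟪magGrad s A u z, magGrad s A v z⟫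

/-- `u : ℝⁿ → ℝ` is a weak solution of `(-Δ)^s_A u = F` in `Ω`, `u = g` in `Ω_e`.

The function `u` is measurable, its restriction to `Ω` lies in `H^s(Ω)`, and `∇^s u` is square
integrable on `{(x, y) : x ∈ Ω or y ∈ Ω}`. The last condition is what gives a meaning to
`⟨∇^s_A u, ∇^s_A φ⟩` for all `φ` in the closure of `C_c^∞(Ω)` in `H^s(ℝⁿ)`; note that `∇^s_A φ`
vanishes where neither `x` nor `y` lies in `Ω`. Every `u ∈ H^s(ℝⁿ)` satisfies these conditions, and
so does every sum of such a `u` and a constant. The equation holds in the sense of distributions in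
`Ω`; by density it is the same to test it with the closure of `C_c^∞(Ω)` in `H^s(ℝⁿ)`. -/
structure IsWeakSolution {n : ℕ} (s : ℝ) (Ω : Set (Rn n)) (A : Rn n × Rn n → Rn n)
    (F g : Rn n → ℝ) (u : Rn n → ℝ) : Prop where
  aestronglyMeasurable : AEStronglyMeasurable u volume
  memHsOn : MemHsOn s Ω u
  finite_energy : MemLp (fracGrad s u) 2 (volume.restrict {z | z.1 ∈ Ω ∨ z.2 ∈ Ω})
  equation : ∀ φ : Rn n → ℝ, IsTestFunction Ω φ → magForm s A u φ = ∫ x in Ω, F x * φ x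
  exterior_value : u =ᵐ[volume.restrict (exterior Ω)] g

end FMSE

end

noncomputable section

namespace FMSE

open Filter Topology Pointwise

variable {n : ℕ} {s : ℝ} {Ω : Set (Rn n)} {u v φ ψ F g : Rn n → ℝ} {z : Rn n × Rn n}
  {A B : Rn n × Rn n → Rn n}

/-! ### Algebra of the fractional gradient -/

/-! Test the equation with the negative part φ = u⁻. Since u = g ≥ 0 outside, φ vanishes off Ω, and
F ≥ 0 gives ⟨∇ˢ_A u, ∇ˢ_A φ⟩ = ∫ Fφ ≥ 0. The core is a pointwise inequality,
`inner_magGrad_add_swap_le`: after adding the values at (x,y) and (y,x), the integrand ∇ˢ_A u · ∇ˢ_A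
φ is at most −2|∇ˢφ|² minus the symmetrized density `potDensity`. The sign of A_a is what removes
the remaining terms. Integrated, it reads ⟨∇ˢ_A u, ∇ˢ_A φ⟩ + ‖∇ˢφ‖² + ∫ `potDensity` ≤ 0. The last
integral is the effective potential paired with φ², hence nonnegative, so ∇ˢφ = 0. Then φ is a.e.
constant, and the constant is 0 because φ vanishes outside a bounded set.

Both the equation and the sign of the potential are known only on C_c^∞(Ω), whereas φ is not smooth.
The analytic work is therefore a density theorem, `IsBoundedLipschitzDomain.isApproximable`: on a
Lipschitz domain every φ in L² with ∇ˢφ in L² and φ = 0 off Ω is a limit of test functions. Cut φ by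
a partition of unity, push each piece into Ω and mollify. Both statements pass to the limit by
continuity of L² pairings. -/

/-- The scalar weight of the fractional gradient. -/
def fracWeight (s : ℝ) (z : Rn n × Rn n) : ℝ :=
  Real.sqrt (fracConst n s / 2) / ‖z.2 - z.1‖ ^ ((n : ℝ) / 2 + s + 1)

theorem fracGrad_eq (s : ℝ) (u : Rn n → ℝ) (z : Rn n × Rn n) :
    fracGrad s u z = (u z.1 - u z.2) • fracWeight s z • (z.2 - z.1) := by
  rw [fracGrad, fracWeight, smul_smul]
  congr 1
  ring

theorem fracWeight_swap (s : ℝ) (z : Rn n × Rn n) : fracWeight s z.swap = fracWeight s z := by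
  simp [fracWeight, norm_sub_rev]

theorem fracWeight_nonneg (s : ℝ) (z : Rn n × Rn n) : 0 ≤ fracWeight s z := by
  unfold fracWeight
  positivity

theorem fracGrad_sub (s : ℝ) (u v : Rn n → ℝ) :
    fracGrad s (u - v) = fracGrad s u - fracGrad s v := by
  ext1 z
  simp only [fracGrad_eq, Pi.sub_apply, ← sub_smul]
  congr 1
  ring

theorem fracGrad_swap (s : ℝ) (u : Rn n → ℝ) (z : Rn n × Rn n) :
    fracGrad s u z.swap = fracGrad s u z := by
  rw [fracGrad_eq, fracGrad_eq, fracWeight_swap, Prod.fst_swap, Prod.snd_swap,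
    ← neg_sub (u z.1), ← neg_sub z.2, smul_neg, smul_neg, neg_smul, neg_neg]

theorem norm_fracGrad (s : ℝ) (u : Rn n → ℝ) (z : Rn n × Rn n) :
    ‖fracGrad s u z‖ = |u z.1 - u z.2| * ‖fracWeight s z • (z.2 - z.1)‖ := by
  rw [fracGrad_eq, norm_smul, Real.norm_eq_abs]

theorem norm_fracGrad_mono (h : |u z.1 - u z.2| ≤ |v z.1 - v z.2|) :
    ‖fracGrad s u z‖ ≤ ‖fracGrad s v z‖ := by
  rw [norm_fracGrad, norm_fracGrad]
  gcongr

theorem fracGrad_of_eq (h : u z.1 = u z.2) : fracGrad s u z = 0 := by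
  rw [fracGrad_eq, h, sub_self, zero_smul]

/-- One factor is evaluated at x and the other at y. Since ∇ˢ is invariant under swapping x and y, a
swap puts the second term in the same form as the first. -/
theorem fracGrad_mul (s : ℝ) (u v : Rn n → ℝ) (z : Rn n × Rn n) :
    fracGrad s (fun x => u x * v x) z = u z.1 • fracGrad s v z + v z.2 • fracGrad s u z := by
  simp only [fracGrad_eq, smul_smul, ← add_smul]
  congr 1
  ring

theorem measurable_fracWeight_smul (s : ℝ) :
    Measurable fun z : Rn n × Rn n => fracWeight s z • (z.2 - z.1) := by
  unfold fracWeight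
  fun_prop

theorem ae_prod_of_ae {p : Rn n → Prop} (h : ∀ᵐ x, p x) :
    ∀ᵐ z : Rn n × Rn n, p z.1 ∧ p z.2 :=
  (Measure.quasiMeasurePreserving_fst.ae h).and (Measure.quasiMeasurePreserving_snd.ae h)

theorem aestronglyMeasurable_fracGrad (s : ℝ) (hu : AEStronglyMeasurable u volume) :
    AEStronglyMeasurable (fracGrad s u) volume := by
  have h1 : AEStronglyMeasurable (fun z : Rn n × Rn n => u z.1 - u z.2) volume :=
    hu.comp_fst.sub hu.comp_snd
  exact (h1.smul (measurable_fracWeight_smul s).aestronglyMeasurable).congr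
    (.of_forall fun z => (fracGrad_eq s u z).symm)

theorem measurePreserving_prod_swap :
    MeasurePreserving (Prod.swap : Rn n × Rn n → Rn n × Rn n) volume volume :=
  Measure.measurePreserving_swap

theorem fracConst_pos (hn : 0 < n) (hs0 : 0 < s) (hs1 : s < 1) : 0 < fracConst n s := by
  have h1 : Real.Gamma (-s) ≠ 0 := by
    refine Real.Gamma_ne_zero fun m hm => ?_
    have h2 : s = m := neg_injective hm
    rw [h2] at hs0 hs1
    norm_cast at hs0 hs1
    omega
  have h2 : 0 < Real.Gamma (n / 2 + s) := Real.Gamma_pos_of_pos (by positivity)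
  have h3 : 0 < |Real.Gamma (-s)| := abs_pos.2 h1
  unfold fracConst
  positivity

theorem eq_of_fracGrad_eq_zero (hn : 0 < n) (hs0 : 0 < s) (hs1 : s < 1)
    (h : fracGrad s u z = 0) (hz : z.1 ≠ z.2) : u z.1 = u z.2 := by
  have h1 : z.2 - z.1 ≠ 0 := sub_ne_zero.2 hz.symm
  have h2 : 0 < ‖z.2 - z.1‖ := norm_pos_iff.2 h1
  have h3 : 0 < fracWeight s z := by
    have := fracConst_pos hn hs0 hs1
    unfold fracWeight
    positivity
  rw [fracGrad_eq, smul_eq_zero, smul_eq_zero] at h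
  rcases h with h | h | h
  · linarith
  · exact absurd h h3.ne'
  · exact absurd h h1

/-! ### Integrability of the kernel and multiplication by smooth functions -/

/-- In polar coordinates the integrand is at most L² r^(1−2s) near 0, integrable as s < 1, and M²
r^(−1−2s) at infinity, integrable as s > 0. -/
theorem integrable_radial_kernel (hn : 0 < n) (hs0 : 0 < s) (hs1 : s < 1) {L M : ℝ}
    (hL : 0 ≤ L) (hM : 0 ≤ M) :
    Integrable (fun h : Rn n => min (L * ‖h‖) M ^ 2 * ‖h‖ ^ (-((n : ℝ) + 2 * s))) volume := by
  have : Nonempty (Fin n) := ⟨⟨0, hn⟩⟩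
  have : Nontrivial (Rn n) := inferInstance
  refine (integrable_fun_norm_addHaar (volume : Measure (Rn n))
    (f := fun r => min (L * r) M ^ 2 * r ^ (-((n : ℝ) + 2 * s)))).2 ?_
  have hpow : ∀ r : ℝ, 0 < r → ∀ a : ℝ,
      r ^ (n - 1) * (a * r ^ (-((n : ℝ) + 2 * s))) = a * r ^ (-1 - 2 * s) := by
    intro r hr a
    rw [← Real.rpow_natCast, Nat.cast_pred hn, mul_left_comm, ← Real.rpow_add hr]
    ring_nf
  have hmeas : ∀ S : Set ℝ, AEStronglyMeasurable
      (fun r : ℝ => r ^ (Module.finrank ℝ (Rn n) - 1) •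
        (min (L * r) M ^ 2 * r ^ (-((n : ℝ) + 2 * s)))) (volume.restrict S) := fun S => by
    have : Measurable fun r : ℝ => r ^ (Module.finrank ℝ (Rn n) - 1) •
        (min (L * r) M ^ 2 * r ^ (-((n : ℝ) + 2 * s))) := by fun_prop
    exact this.aestronglyMeasurable
  rw [← Ioc_union_Ioi_eq_Ioi (zero_le_one' ℝ), integrableOn_union]
  constructor
  · have h1 : IntegrableOn (fun r : ℝ => L ^ 2 * r ^ (1 - 2 * s)) (Ioc 0 1) :=
      ((intervalIntegrable_iff_integrableOn_Ioc_of_le zero_le_one).1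
        (intervalIntegral.intervalIntegrable_rpow' (by linarith))).const_mul _
    refine Integrable.mono' h1 (hmeas _) ?_
    filter_upwards [ae_restrict_mem measurableSet_Ioc] with r hr
    have hr0 : 0 < r := hr.1
    rw [finrank_euclideanSpace_fin, smul_eq_mul, hpow r hr0, Real.norm_of_nonneg (by positivity)]
    have h2 : min (L * r) M ^ 2 ≤ (L * r) ^ 2 :=
      pow_le_pow_left₀ (le_min (by positivity) hM) (min_le_left _ _) 2
    calc min (L * r) M ^ 2 * r ^ (-1 - 2 * s) ≤ (L * r) ^ 2 * r ^ (-1 - 2 * s) := by gcongr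
      _ = L ^ 2 * (r ^ (2 : ℝ) * r ^ (-1 - 2 * s)) := by rw [Real.rpow_two]; ring
      _ = L ^ 2 * r ^ (1 - 2 * s) := by rw [← Real.rpow_add hr0]; ring_nf
  · have h1 : IntegrableOn (fun r : ℝ => M ^ 2 * r ^ (-1 - 2 * s)) (Ioi 1) :=
      (integrableOn_Ioi_rpow_of_lt (by linarith) one_pos).const_mul _
    refine Integrable.mono' h1 (hmeas _) ?_
    filter_upwards [ae_restrict_mem measurableSet_Ioi] with r hr
    have hr0 : 0 < r := one_pos.trans hr
    rw [finrank_euclideanSpace_fin, smul_eq_mul, hpow r hr0, Real.norm_of_nonneg (by positivity)]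
    have h2 : min (L * r) M ^ 2 ≤ M ^ 2 :=
      pow_le_pow_left₀ (le_min (by positivity) hM) (min_le_right _ _) 2
    gcongr

theorem sq_norm_fracGrad_le {L M : ℝ} {χ : Rn n → ℝ}
    (hL : ∀ x y, |χ x - χ y| ≤ L * ‖y - x‖) (hM : ∀ x y, |χ x - χ y| ≤ M) (z : Rn n × Rn n) :
    ‖fracGrad s χ z‖ ^ 2 ≤ Real.sqrt (fracConst n s / 2) ^ 2 *
      (min (L * ‖z.2 - z.1‖) M ^ 2 * ‖z.2 - z.1‖ ^ (-((n : ℝ) + 2 * s))) := by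
  rcases eq_or_ne z.1 z.2 with hz | hz
  · rw [fracGrad_of_eq (by rw [hz]), norm_zero, zero_pow two_ne_zero]
    positivity
  · have h0 : 0 < ‖z.2 - z.1‖ := norm_pos_iff.2 (sub_ne_zero.2 hz.symm)
    have h1 : |χ z.1 - χ z.2| ^ 2 ≤ min (L * ‖z.2 - z.1‖) M ^ 2 :=
      pow_le_pow_left₀ (abs_nonneg _) (le_min (hL _ _) (hM _ _)) 2
    have h2 : ‖fracWeight s z • (z.2 - z.1)‖ ^ 2 =
        Real.sqrt (fracConst n s / 2) ^ 2 * ‖z.2 - z.1‖ ^ (-((n : ℝ) + 2 * s)) := by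
      rw [norm_smul, Real.norm_of_nonneg (fracWeight_nonneg s z), fracWeight, div_mul_eq_mul_div,
        mul_div_assoc, mul_pow]
      congr 1
      rw [div_pow, ← Real.rpow_natCast, ← Real.rpow_natCast (_ ^ _), ← Real.rpow_mul h0.le,
        ← Real.rpow_sub h0]
      congr 1
      push_cast
      ring
    rw [norm_fracGrad, mul_pow, h2, mul_left_comm]
    gcongr

/-- The bound on |∇ˢχ|² depends only on y − x, so the substitution (x, y) ↦ (x, y − x) factors the
integral into ‖f‖² and the radial kernel. -/
theorem memLp_smul_fracGrad (hn : 0 < n) (hs0 : 0 < s) (hs1 : s < 1) {L M : ℝ} {f χ : Rn n → ℝ}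
    (hf : MemLp f 2 volume) (hχ : AEStronglyMeasurable χ volume)
    (hL : ∀ x y, |χ x - χ y| ≤ L * ‖y - x‖) (hM : ∀ x y, |χ x - χ y| ≤ M) :
    MemLp (fun z : Rn n × Rn n => f z.1 • fracGrad s χ z) 2 volume := by
  have hM0 : 0 ≤ M := (abs_nonneg _).trans (hM 0 0)
  have hL' : ∀ x y, |χ x - χ y| ≤ |L| * ‖y - x‖ := fun x y =>
    (hL x y).trans (mul_le_mul_of_nonneg_right (le_abs_self L) (norm_nonneg _))
  have hmeas : AEStronglyMeasurable (fun z : Rn n × Rn n => f z.1 • fracGrad s χ z) volume :=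
    hf.1.comp_fst.smul (aestronglyMeasurable_fracGrad s hχ)
  rw [memLp_two_iff_integrable_sq_norm hmeas]
  have h1 := (hf.integrable_sq.mul_prod
    (integrable_radial_kernel (M := M) hn hs0 hs1 (abs_nonneg L) hM0))
  have h2 := ((measurePreserving_prod_neg_add (volume : Measure (Rn n))
    (volume : Measure (Rn n))).integrable_comp_of_integrable h1).const_mul
      (Real.sqrt (fracConst n s / 2) ^ 2)
  refine Integrable.mono' h2 (hmeas.norm.pow 2) (.of_forall fun z => ?_)
  rw [Real.norm_of_nonneg (by positivity), norm_smul, mul_pow, Real.norm_eq_abs, sq_abs]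
  have h3 := mul_le_mul_of_nonneg_left (sq_norm_fracGrad_le (s := s) hL' hM z) (sq_nonneg (f z.1))
  refine h3.trans_eq ?_
  simp only [Function.comp_apply, neg_add_eq_sub]
  ring

theorem memLp_bdd_smul {X E : Type*} [MeasurableSpace X] {μ : Measure X} [NormedAddCommGroup E]
    [NormedSpace ℝ E] {f : X → ℝ} {g : X → E} {M : ℝ} (hg : MemLp g 2 μ)
    (hf : AEStronglyMeasurable f μ) (hM : ∀ᵐ x ∂μ, ‖f x‖ ≤ M) :
    MemLp (fun x => f x • g x) 2 μ := by
  refine hg.of_le_mul (c := M) (hf.smul hg.1) ?_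
  filter_upwards [hM] with x hx
  rw [norm_smul]
  gcongr

theorem memLp_fracGrad_mul (hn : 0 < n) (hs0 : 0 < s) (hs1 : s < 1) {φ χ : Rn n → ℝ}
    (hφ : MemLp φ 2 volume) (hφ' : MemLp (fracGrad s φ) 2 volume)
    (hχ : ContDiff ℝ 1 χ) (hχc : HasCompactSupport χ) :
    MemLp (fracGrad s fun x => χ x * φ x) 2 volume := by
  obtain ⟨L, hL⟩ := hχ.lipschitzWith_of_hasCompactSupport hχc one_ne_zero
  obtain ⟨M, hM⟩ := hχc.exists_bound_of_continuous hχ.continuous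
  have hL' : ∀ x y, |χ x - χ y| ≤ L * ‖y - x‖ := fun x y => by
    simpa [Real.norm_eq_abs, norm_sub_rev y x] using hL.norm_sub_le x y
  have hM' : ∀ x y, |χ x - χ y| ≤ M + M := fun x y => by
    have h1 := norm_sub_le (χ x) (χ y)
    rw [← Real.norm_eq_abs]
    linarith [hM x, hM y]
  have h1 := memLp_smul_fracGrad hn hs0 hs1 hφ hχ.continuous.aestronglyMeasurable hL' hM'
  have h2 := h1.comp_measurePreserving measurePreserving_prod_swap
  have h3 : MemLp (fun z : Rn n × Rn n => χ z.1 • fracGrad s φ z) 2 volume :=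
    memLp_bdd_smul hφ' hχ.continuous.aestronglyMeasurable.comp_fst
      (.of_forall fun z => hM z.1)
  refine (h3.add h2).ae_eq (.of_forall fun z => ?_)
  simp only [Pi.add_apply, Function.comp_apply, fracGrad_mul, fracGrad_swap, Prod.fst_swap]

theorem memLp_mul_of_continuous {φ χ : Rn n → ℝ} (hφ : MemLp φ 2 volume) (hχ : Continuous χ)
    (hχc : HasCompactSupport χ) : MemLp (fun x => χ x * φ x) 2 volume := by
  obtain ⟨M, hM⟩ := hχc.exists_bound_of_continuous hχ
  exact memLp_bdd_smul hφ hχ.aestronglyMeasurable (.of_forall hM)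

/-! ### Averages of translates in `L²` -/

theorem eLpNorm_two_rpow_two {X E : Type*} [MeasurableSpace X] [NormedAddCommGroup E]
    (μ : Measure X) (f : X → E) : eLpNorm f 2 μ ^ (2 : ℝ) = ∫⁻ x, ‖f x‖ₑ ^ (2 : ℝ) ∂μ :=
  eLpNorm_nnreal_pow_eq_lintegral (p := 2) two_ne_zero

/-- Cauchy–Schwarz against the probability measure ν, then Tonelli. -/
theorem eLpNorm_two_integral_le {X Y E : Type*} [MeasurableSpace X] [MeasurableSpace Y]
    [NormedAddCommGroup E] [NormedSpace ℝ E] {μ : Measure X} [SFinite μ] {ν : Measure Y}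
    [IsProbabilityMeasure ν] {Φ : Y → X → E}
    (hΦ : AEStronglyMeasurable (fun p : Y × X => Φ p.1 p.2) (ν.prod μ)) {ε : ℝ≥0∞}
    (hε : ∀ᵐ y ∂ν, eLpNorm (Φ y) 2 μ ≤ ε) :
    eLpNorm (fun x => ∫ y, Φ y x ∂ν) 2 μ ≤ ε := by
  have hswap : AEStronglyMeasurable (fun p : X × Y => Φ p.2 p.1) (μ.prod ν) := hΦ.prod_swap
  rw [← ENNReal.rpow_le_rpow_iff (zero_lt_two' ℝ)]
  calc eLpNorm (fun x => ∫ y, Φ y x ∂ν) 2 μ ^ (2 : ℝ)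
      = ∫⁻ x, ‖∫ y, Φ y x ∂ν‖ₑ ^ (2 : ℝ) ∂μ := eLpNorm_two_rpow_two _ _
    _ ≤ ∫⁻ x, ∫⁻ y, ‖Φ y x‖ₑ ^ (2 : ℝ) ∂ν ∂μ := by
        refine lintegral_mono_ae ?_
        filter_upwards [hswap.prodMk_left] with x hx
        have h1 : ‖∫ y, Φ y x ∂ν‖ₑ ≤ eLpNorm (fun y => Φ y x) 2 ν :=
          (enorm_integral_le_lintegral_enorm _).trans
            (eLpNorm_one_eq_lintegral_enorm.symm.le.trans
              (eLpNorm_le_eLpNorm_of_exponent_le one_le_two hx))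
        have := ENNReal.rpow_le_rpow h1 (zero_le_two (α := ℝ))
        rwa [eLpNorm_two_rpow_two] at this
    _ = ∫⁻ y, ∫⁻ x, ‖Φ y x‖ₑ ^ (2 : ℝ) ∂μ ∂ν :=
        lintegral_lintegral_swap (hswap.enorm.pow_const _)
    _ ≤ ∫⁻ _, ε ^ (2 : ℝ) ∂ν := by
        refine lintegral_mono_ae ?_
        filter_upwards [hε] with y hy
        rw [← eLpNorm_two_rpow_two]
        gcongr
    _ = ε ^ (2 : ℝ) := by simp

section Translation

variable {X E : Type*} [NormedAddCommGroup X] [NormedSpace ℝ X] [FiniteDimensional ℝ X]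
  [MeasurableSpace X] [BorelSpace X] [NormedAddCommGroup E] {μ : Measure X}
  [μ.IsAddHaarMeasure]

theorem tendsto_eLpNorm_sub_translate {G : X → E} (hG : MemLp G 2 μ) :
    Tendsto (fun h : X => eLpNorm (fun z => G z - G (z - h)) 2 μ) (𝓝 0) (𝓝 0) := by
  have : Fact ((2 : ℝ≥0∞) ≠ ⊤) := ⟨ENNReal.ofNat_ne_top⟩
  have h1 : Continuous fun h : X => DomAddAct.mk (-h) +ᵥ hG.toLp G :=
    (DomAddAct.continuous_mk.comp continuous_neg).vadd continuous_const
  have h2 : Tendsto (fun h : X => edist (hG.toLp G) (DomAddAct.mk (-h) +ᵥ hG.toLp G)) (𝓝 0)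
      (𝓝 (edist (hG.toLp G) (DomAddAct.mk (-0 : X) +ᵥ hG.toLp G))) :=
    (continuous_const.edist h1).tendsto 0
  rw [neg_zero, DomAddAct.mk_zero, zero_vadd, edist_self] at h2
  refine h2.congr fun h => ?_
  rw [DomAddAct.mk_vadd_toLp, Lp.edist_toLp_toLp]
  refine eLpNorm_congr_ae (.of_forall fun z => ?_)
  simp [neg_add_eq_sub]

/-- The map T lets one averaging measure serve twice: T = id for φ, and T h = (h, h) for ∇ˢφ. -/
theorem exists_eLpNorm_average_translate_le [NormedSpace ℝ E] {Y : Type*} [NormedAddCommGroup Y]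
    [MeasurableSpace Y] [BorelSpace Y] {T : Y → X} (hT : Continuous T)
    (hT0 : T 0 = 0) {G : X → E} (hG : MemLp G 2 μ) {ε : ℝ≥0∞} (hε : ε ≠ 0) :
    ∃ r : ℝ, 0 < r ∧ ∀ ν : Measure Y, IsProbabilityMeasure ν → (∀ᵐ h ∂ν, ‖h‖ < r) →
      eLpNorm (fun z => ∫ h, (G z - G (z - T h)) ∂ν) 2 μ ≤ ε := by
  have h1 := ((tendsto_eLpNorm_sub_translate hG).comp
    (hT.tendsto' 0 0 hT0)).eventually_le_const (pos_iff_ne_zero.2 hε)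
  obtain ⟨r, hr, h2⟩ := Metric.eventually_nhds_iff.1 h1
  refine ⟨r, hr, fun ν hν hνr => eLpNorm_two_integral_le ?_ ?_⟩
  · have hq : Measure.QuasiMeasurePreserving (fun p : Y × X => p.2 - T p.1) (ν.prod μ) μ := by
      refine QuasiMeasurePreserving.prod_of_right ?_ (.of_forall fun h => ?_)
      · exact measurable_snd.sub (hT.measurable.comp measurable_fst)
      · exact (measurePreserving_sub_right μ (T h)).quasiMeasurePreserving
    exact hG.1.comp_snd.sub (hG.1.comp_quasiMeasurePreserving hq)
  · filter_upwards [hνr] with h hh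
    exact h2 (by simpa using hh)

end Translation

theorem isAddHaarMeasure_volume_prod (n : ℕ) :
    (volume : Measure (Rn n × Rn n)).IsAddHaarMeasure :=
  inferInstanceAs ((volume : Measure (Rn n)).prod (volume : Measure (Rn n))).IsAddHaarMeasure

/-! ### Approximation by test functions -/

/-- `φ` belongs to the closure of `C_c^∞(Ω)` for the norm `‖φ‖_{L²} + ‖∇^s φ‖_{L²}`. -/
def IsApproximable (s : ℝ) (Ω : Set (Rn n)) (φ : Rn n → ℝ) : Prop :=
  ∀ ε : ℝ≥0∞, ε ≠ 0 → ∃ ψ, IsTestFunction Ω ψ ∧ eLpNorm (φ - ψ) 2 volume ≤ ε ∧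
    eLpNorm (fracGrad s φ - fracGrad s ψ) 2 volume ≤ ε

/-- Convolve φ with a bump centred at t • e of radius δt: this shifts the support into Ω while
smoothing. The weight of ∇ˢ depends only on y − x, so ∇ˢ commutes with diagonal translations; the
errors in φ and in ∇ˢφ are then averages of differences of L² translates, small as t → 0. -/
theorem isApproximable_of_translate {S : Set (Rn n)}
    (hφ : MemLp φ 2 volume) (hφ' : MemLp (fracGrad s φ) 2 volume) (hS : IsCompact S)
    (hφS : ∀ x ∉ S, φ x = 0) (e : Rn n) {δ : ℝ} (hδ : 0 < δ)
    (hΩ : ∀ᶠ t in 𝓝[>] (0 : ℝ), S + Metric.closedBall (t • e) (δ * t) ⊆ Ω) :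
    IsApproximable s Ω φ := by
  intro ε hε
  obtain ⟨r₁, hr₁, H₁⟩ := exists_eLpNorm_average_translate_le continuous_id rfl hφ hε
  have := isAddHaarMeasure_volume_prod n
  obtain ⟨r₂, hr₂, H₂⟩ := exists_eLpNorm_average_translate_le
    (T := fun h : Rn n => (h, h)) (μ := (volume : Measure (Rn n × Rn n))) (by fun_prop) rfl hφ' hε
  have hsmall : ∀ᶠ t in 𝓝[>] (0 : ℝ), t * ‖e‖ + δ * t < min r₁ r₂ := by
    have : Tendsto (fun t : ℝ => t * ‖e‖ + δ * t) (𝓝 0) (𝓝 0) := by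
      have : Continuous fun t : ℝ => t * ‖e‖ + δ * t := by fun_prop
      exact this.tendsto' 0 0 (by simp)
    exact (this.eventually_lt_const (lt_min hr₁ hr₂)).filter_mono nhdsWithin_le_nhds
  obtain ⟨t, ⟨htΩ, htr⟩, ht⟩ := ((hΩ.and hsmall).and self_mem_nhdsWithin).exists
  have ht0 : 0 < t := ht
  let b : ContDiffBump (t • e) := ⟨δ * t / 2, δ * t, by positivity, by
    have : 0 < δ * t := by positivity
    linarith⟩
  let ρ : Rn n → ℝ := b.normed volume
  -- Writing the mollification as an average over a probability measure makes φ − ψ the average of φ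
  -- − φ(· − h).
  let ν : Measure (Rn n) := volume.withDensity fun h => ENNReal.ofReal (ρ h)
  have hρc : Continuous ρ := b.continuous_normed
  have hρ0 : ∀ h, 0 ≤ ρ h := b.nonneg_normed
  have hρs : HasCompactSupport ρ := b.hasCompactSupport_normed
  have hν : IsProbabilityMeasure ν := ⟨by
    rw [withDensity_apply _ MeasurableSet.univ, Measure.restrict_univ,
      ← ofReal_integral_eq_lintegral_ofReal b.integrable_normed (.of_forall hρ0),
      b.integral_normed, ENNReal.ofReal_one]⟩
  have hball : ∀ᵐ h ∂ν, ‖h‖ < min r₁ r₂ := by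
    refine (ae_withDensity_iff hρc.measurable.ennreal_ofReal).2 (.of_forall fun h hh => ?_)
    have h1 : h ∈ Function.support ρ := fun h0 => hh (by rw [h0, ENNReal.ofReal_zero])
    rw [b.support_normed_eq, mem_ball_iff_norm] at h1
    calc ‖h‖ ≤ ‖t • e‖ + ‖h - t • e‖ := by simpa using norm_add_le (t • e) (h - t • e)
      _ < t * ‖e‖ + δ * t := by
        rw [norm_smul, Real.norm_of_nonneg ht0.le]
        gcongr
      _ < _ := htr
  have hint : ∀ f : Rn n → ℝ, ∫ h, f h ∂ν = ∫ h, ρ h * f h := fun f => by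
    rw [integral_withDensity_eq_integral_toReal_smul hρc.measurable.ennreal_ofReal
      (.of_forall fun _ => ENNReal.ofReal_lt_top)]
    simp [ENNReal.toReal_ofReal (hρ0 _)]
  have hloc : LocallyIntegrable φ volume := hφ.locallyIntegrable one_le_two
  have hintble : ∀ x, Integrable (fun h => φ (x - h)) ν := fun x => by
    rw [integrable_withDensity_iff_integrable_smul' hρc.measurable.ennreal_ofReal
      (.of_forall fun _ => ENNReal.ofReal_lt_top)]
    have := hρs.convolutionExists_left (ContinuousLinearMap.lsmul ℝ ℝ) hρc hloc x
    refine this.congr (.of_forall fun h => ?_)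
    simp [ENNReal.toReal_ofReal (hρ0 _)]
  let ψ : Rn n → ℝ := convolution ρ φ (ContinuousLinearMap.lsmul ℝ ℝ) volume
  have hψ : ∀ x, ψ x = ∫ h, φ (x - h) ∂ν := fun x => (hint _).symm
  have hdiff : ∀ x, φ x - ψ x = ∫ h, (φ x - φ (x - h)) ∂ν := fun x => by
    rw [integral_sub (integrable_const _) (hintble x), hψ]
    simp
  have hsupp : tsupport ψ ⊆ S + Metric.closedBall (t • e) (δ * t) := by
    refine closure_minimal ?_ (hS.add (isCompact_closedBall _ _)).isClosed
    refine (support_convolution_subset _).trans ?_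
    rw [add_comm]
    refine add_subset_add (fun x hx => by_contra fun hxS => hx (hφS x hxS)) ?_
    rw [b.support_normed_eq]
    exact Metric.ball_subset_closedBall
  refine ⟨ψ, ⟨?_, ?_, hsupp.trans htΩ⟩, ?_, ?_⟩
  · exact hρs.contDiff_convolution_left _ b.contDiff_normed hloc
  · exact (hS.add (isCompact_closedBall _ _)).of_isClosed_subset (isClosed_tsupport _) hsupp
  · have h1 := H₁ ν hν (hball.mono fun h hh => hh.trans_le (min_le_left _ _))
    refine (eLpNorm_congr_ae (.of_forall fun x => ?_)).trans_le h1
    exact hdiff x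
  · have h1 := H₂ ν hν (hball.mono fun h hh => hh.trans_le (min_le_right _ _))
    refine (eLpNorm_congr_ae (.of_forall fun z => ?_)).trans_le h1
    have h2 : ∀ x, Integrable (fun h => φ x - φ (x - h)) ν := fun x =>
      (integrable_const _).sub (hintble x)
    rw [← fracGrad_sub, fracGrad_eq, Pi.sub_apply, Pi.sub_apply, hdiff, hdiff,
      ← integral_sub (h2 _) (h2 _), ← integral_smul_const]
    refine integral_congr_ae (.of_forall fun h => ?_)
    have h3 : fracGrad s φ (z - (h, h)) =
        (φ (z.1 - h) - φ (z.2 - h)) • fracWeight s z • (z.2 - z.1) := by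
      simp [fracGrad_eq, fracWeight]
    simp only [h3, fracGrad_eq s φ z, ← sub_smul]
    congr 1
    ring

/-! ### Sums of approximable functions -/

theorem IsTestFunction.add (hφ : IsTestFunction Ω φ) (hψ : IsTestFunction Ω ψ) :
    IsTestFunction Ω (φ + ψ) where
  contDiff := hφ.contDiff.add hψ.contDiff
  hasCompactSupport := hφ.hasCompactSupport.add hψ.hasCompactSupport
  tsupport_subset :=
    (tsupport_add φ ψ).trans (union_subset hφ.tsupport_subset hψ.tsupport_subset)

theorem IsTestFunction.zero : IsTestFunction Ω (0 : Rn n → ℝ) where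
  contDiff := contDiff_const
  hasCompactSupport := .zero
  tsupport_subset := by simp [tsupport]

theorem fracGrad_add (s : ℝ) (u v : Rn n → ℝ) :
    fracGrad s (u + v) = fracGrad s u + fracGrad s v := by
  rw [← sub_eq_iff_eq_add, ← fracGrad_sub, add_sub_cancel_right]

theorem IsTestFunction.continuous (hφ : IsTestFunction Ω φ) : Continuous φ :=
  hφ.contDiff.continuous

theorem IsTestFunction.memLp (hφ : IsTestFunction Ω φ) : MemLp φ 2 volume :=
  hφ.continuous.memLp_of_hasCompactSupport hφ.hasCompactSupport

theorem IsApproximable.zero : IsApproximable s Ω (0 : Rn n → ℝ) := fun ε _ =>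
  ⟨0, .zero, by simp, by simp⟩

theorem IsApproximable.add (hφm : AEStronglyMeasurable φ volume)
    (hψm : AEStronglyMeasurable ψ volume) (hφ : IsApproximable s Ω φ)
    (hψ : IsApproximable s Ω ψ) : IsApproximable s Ω (φ + ψ) := by
  intro ε hε
  have hε2 : ε / 2 ≠ 0 := (ENNReal.half_pos hε).ne'
  obtain ⟨φ₁, h1, h2, h3⟩ := hφ _ hε2
  obtain ⟨ψ₁, k1, k2, k3⟩ := hψ _ hε2
  have m1 := h1.continuous.aestronglyMeasurable (μ := volume)
  have m2 := k1.continuous.aestronglyMeasurable (μ := volume)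
  refine ⟨φ₁ + ψ₁, h1.add k1, ?_, ?_⟩
  · rw [add_sub_add_comm, ← ENNReal.add_halves ε]
    exact (eLpNorm_add_le (hφm.sub m1) (hψm.sub m2) one_le_two).trans (add_le_add h2 k2)
  · rw [fracGrad_add, fracGrad_add, add_sub_add_comm, ← ENNReal.add_halves ε]
    refine (eLpNorm_add_le ?_ ?_ one_le_two).trans (add_le_add h3 k3)
    · exact (aestronglyMeasurable_fracGrad s hφm).sub (aestronglyMeasurable_fracGrad s m1)
    · exact (aestronglyMeasurable_fracGrad s hψm).sub (aestronglyMeasurable_fracGrad s m2)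

theorem IsApproximable.sum {ι : Type*} (t : Finset ι) {f : ι → Rn n → ℝ}
    (hm : ∀ i, AEStronglyMeasurable (f i) volume) (hf : ∀ i, IsApproximable s Ω (f i)) :
    IsApproximable s Ω (∑ i ∈ t, f i) := by
  classical
  induction t using Finset.induction_on with
  | empty => simpa using .zero
  | insert i t hi ih =>
    rw [Finset.sum_insert hi]
    exact (hf i).add (hm i) (Finset.aestronglyMeasurable_sum _ fun j _ => hm j) ih

/-! ### Lipschitz domains -/

/-- The vertical translates by e/(k+1) are pairwise disjoint, since a graph meets each vertical line
once, and a set with infinitely many disjoint translates by bounded vectors is null. -/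
theorem graph_measure_zero {e : Rn n} (he : ‖e‖ = 1) {γ : Rn n → ℝ} (hγ : Continuous γ) :
    volume {x : Rn n | γ (x - ⟪e, x⟫ • e) = ⟪e, x⟫} = 0 := by
  refine Measure.addHaar_eq_zero_of_disjoint_translates volume
    (fun k : ℕ => (1 / ((k : ℝ) + 1)) • e) ?_ ?_ ?_
  · refine isBounded_iff_forall_norm_le.2 ⟨1, ?_⟩
    rintro _ ⟨k, rfl⟩
    rw [norm_smul, he, mul_one, Real.norm_of_nonneg (by positivity), div_le_one (by positivity)]
    linarith [(Nat.cast_nonneg k : (0 : ℝ) ≤ k)]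
  · intro j k hjk
    refine Set.disjoint_left.2 fun y hj hk => hjk ?_
    simp only [singleton_add, mem_image, mem_ofPred_eq] at hj hk
    obtain ⟨a, ha, hay⟩ := hj
    obtain ⟨b, hb, hby⟩ := hk
    have hee : ⟪e, e⟫ = (1 : ℝ) := by rw [real_inner_self_eq_norm_sq, he, one_pow]
    have hab : b = a + ((1 / ((j : ℝ) + 1)) - 1 / ((k : ℝ) + 1)) • e := by
      rw [sub_smul, ← add_sub_assoc, add_comm a, hay, ← hby, add_sub_cancel_left]
    have h1 : ⟪e, b⟫ = ⟪e, a⟫ + ((1 / ((j : ℝ) + 1)) - 1 / ((k : ℝ) + 1)) := by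
      rw [hab, inner_add_right, inner_smul_right, hee, mul_one]
    have h2 : b - ⟪e, b⟫ • e = a - ⟪e, a⟫ • e := by
      rw [h1, add_smul, hab]
      abel
    rw [h2, ha, h1] at hb
    have h3 : 1 / ((j : ℝ) + 1) = 1 / ((k : ℝ) + 1) := by linarith
    have h4 : (j : ℝ) + 1 = k + 1 := by
      rwa [div_eq_div_iff (by positivity) (by positivity), one_mul, one_mul, eq_comm] at h3
    exact_mod_cast add_right_cancel h4
  · have h1 : Continuous fun x : Rn n => γ (x - ⟪e, x⟫ • e) := by fun_prop
    exact (isClosed_eq h1 (by fun_prop)).measurableSet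

theorem IsBoundedLipschitzDomain.le_of_mem_closure {x₀ e x : Rn n} {r : ℝ} {γ : Rn n → ℝ}
    (hγ : Continuous γ)
    (h : ∀ x ∈ Metric.ball x₀ r, (x ∈ Ω ↔ γ (x - ⟪e, x⟫ • e) < ⟪e, x⟫))
    (hx : x ∈ closure Ω) (hxr : x ∈ Metric.ball x₀ r) : γ (x - ⟪e, x⟫ • e) ≤ ⟪e, x⟫ := by
  have h1 : x ∈ closure (Metric.ball x₀ r ∩ Ω) := Metric.isOpen_ball.inter_closure ⟨hxr, hx⟩
  have h2 : IsClosed {x : Rn n | γ (x - ⟪e, x⟫ • e) ≤ ⟪e, x⟫} := by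
    have h1 : Continuous fun x : Rn n => γ (x - ⟪e, x⟫ • e) := by fun_prop
    exact isClosed_le h1 (by fun_prop)
  exact closure_minimal (fun y hy => ((h y hy.1).1 hy.2).le) h2 h1

theorem IsBoundedLipschitzDomain.volume_frontier (hΩ : IsBoundedLipschitzDomain Ω) :
    volume (frontier Ω) = 0 := by
  refine measure_null_of_locally_null _ fun x₀ hx₀ => ?_
  obtain ⟨r, hr, e, he, K, γ, hγ, h⟩ := hΩ.lipschitz_boundary x₀ hx₀
  refine ⟨frontier Ω ∩ Metric.ball x₀ r,
    inter_mem_nhdsWithin _ (Metric.ball_mem_nhds x₀ hr), ?_⟩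
  refine measure_mono_null (fun x hx => ?_) (graph_measure_zero he hγ.continuous)
  have h1 := le_of_mem_closure hγ.continuous h hx.1.1 hx.2
  refine h1.antisymm (not_lt.1 fun h2 => ?_)
  rw [hΩ.isOpen.frontier_eq] at hx
  exact hx.1.2 ((h x hx.2).2 h2)

/-- Near a boundary point the direction e points into Ω above a Lipschitz graph, so a whole cone of
small shifts around e leads from the closure into Ω. At an interior point any small shift works,
with e = 0. The direction and aperture depend only on x₀; only the range of t depends on S. -/
theorem IsBoundedLipschitzDomain.exists_translate (hΩ : IsBoundedLipschitzDomain Ω) {x₀ : Rn n}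
    (hx₀ : x₀ ∈ closure Ω) : ∃ R : ℝ, 0 < R ∧ ∃ (e : Rn n) (δ : ℝ), 0 < δ ∧
      ∀ S : Set (Rn n), IsCompact S → S ⊆ closure Ω ∩ Metric.ball x₀ R →
        ∀ᶠ t in 𝓝[>] (0 : ℝ), S + Metric.closedBall (t • e) (δ * t) ⊆ Ω := by
  by_cases hx₀Ω : x₀ ∈ Ω
  · obtain ⟨R, hR, hRΩ⟩ := Metric.isOpen_iff.1 hΩ.isOpen x₀ hx₀Ω
    refine ⟨R, hR, 0, 1, one_pos, fun S hS hSR => ?_⟩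
    obtain ⟨ε, hε, hεΩ⟩ := hS.exists_cthickening_subset_open hΩ.isOpen
      (hSR.trans (inter_subset_right.trans hRΩ))
    filter_upwards [Ioo_mem_nhdsGT hε] with t ht
    rw [smul_zero, one_mul]
    rintro _ ⟨x, hx, y, hy, rfl⟩
    refine hεΩ (Metric.mem_cthickening_of_dist_le _ x _ _ hx ?_)
    rw [mem_closedBall_zero_iff] at hy
    simpa using hy.trans ht.2.le
  · obtain ⟨r, hr, e, he, K, γ, hγ, h⟩ := hΩ.lipschitz_boundary x₀ ⟨hx₀, by
      rwa [hΩ.isOpen.interior_eq]⟩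
    have hee : ⟪e, e⟫ = (1 : ℝ) := by rw [real_inner_self_eq_norm_sq, he, one_pow]
    have hK : (0 : ℝ) ≤ K := K.2
    -- A shift t • e + w with ‖w‖ ≤ δt raises the height by at least t − δt and the graph by at most
    -- 2Kδt. This δ makes δ(1 + 2K) = 1/2, leaving a margin t/2.
    refine ⟨r, hr, e, 1 / (2 * (1 + 2 * K)), by positivity, fun S hS hSR => ?_⟩
    obtain ⟨ε, hε, hεΩ⟩ := hS.exists_cthickening_subset_open Metric.isOpen_ball
      (hSR.trans inter_subset_right)
    set δ : ℝ := 1 / (2 * (1 + 2 * K)) with hδ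
    have hδ0 : 0 < δ := by positivity
    have hδ1 : δ * (1 + 2 * K) = 1 / 2 := by rw [hδ]; field_simp
    have hδ2 : δ ≤ 1 := by nlinarith
    filter_upwards [Ioo_mem_nhdsGT (half_pos hε)] with t ht
    have ht0 : 0 < t := ht.1
    rintro _ ⟨x, hx, y, hy, rfl⟩
    obtain ⟨w, rfl⟩ : ∃ w, y = t • e + w := ⟨y - t • e, by simp⟩
    have hw : ‖w‖ ≤ δ * t := by simpa [mem_closedBall_iff_norm] using hy
    have hball : x + (t • e + w) ∈ Metric.ball x₀ r := by
      refine hεΩ (Metric.mem_cthickening_of_dist_le _ x _ _ hx ?_)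
      rw [dist_eq_norm, add_sub_cancel_left]
      calc ‖t • e + w‖ ≤ t + δ * t := by
            refine (norm_add_le _ _).trans (add_le_add ?_ hw)
            rw [norm_smul, he, mul_one, Real.norm_of_nonneg ht0.le]
        _ ≤ t + 1 * t := by gcongr
        _ ≤ ε := by linarith [ht.2]
    refine (h _ hball).2 ?_
    have h1 := le_of_mem_closure hγ.continuous h (hSR hx).1 (hSR hx).2
    have h2 : ⟪e, x + (t • e + w)⟫ = ⟪e, x⟫ + t + ⟪e, w⟫ := by
      rw [inner_add_right, inner_add_right, inner_smul_right, hee]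
      ring
    have h3 : x + (t • e + w) - ⟪e, x + (t • e + w)⟫ • e =
        (x - ⟪e, x⟫ • e) + (w - ⟪e, w⟫ • e) := by
      rw [h2, add_smul, add_smul]
      abel
    have h4 : |⟪e, w⟫| ≤ ‖w‖ := by simpa [he] using abs_real_inner_le_norm e w
    have h5 : ‖w - ⟪e, w⟫ • e‖ ≤ 2 * ‖w‖ := by
      refine (norm_sub_le _ _).trans ?_
      rw [norm_smul, he, mul_one, Real.norm_eq_abs]
      linarith
    have h6 := hγ.norm_sub_le ((x - ⟪e, x⟫ • e) + (w - ⟪e, w⟫ • e)) (x - ⟪e, x⟫ • e)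
    rw [add_sub_cancel_left, Real.norm_eq_abs] at h6
    have h7 := (le_abs_self _).trans (h6.trans (mul_le_mul_of_nonneg_left h5 hK))
    rw [h3, h2]
    have h8 := (abs_le.1 h4).1
    have h9 : (1 + 2 * K) * ‖w‖ ≤ (1 + 2 * K) * (δ * t) := by gcongr
    have h10 : (1 + 2 * K) * (δ * t) = t / 2 := by
      rw [← mul_assoc, mul_comm _ δ, hδ1]
      ring
    linarith

/-- A finite smooth partition of unity on the compact closure of Ω splits φ into pieces, each
supported in one ball where a single inward direction is available. -/
theorem IsBoundedLipschitzDomain.isApproximable (hΩ : IsBoundedLipschitzDomain Ω) (hn : 0 < n)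
    (hs0 : 0 < s) (hs1 : s < 1) (hφ : MemLp φ 2 volume) (hφ' : MemLp (fracGrad s φ) 2 volume)
    (hφΩ : ∀ x ∉ Ω, φ x = 0) : IsApproximable s Ω φ := by
  have hcomp : IsCompact (closure Ω) := hΩ.isBounded.isCompact_closure
  choose! R hR e δ hδ hS using fun x₀ hx₀ => hΩ.exists_translate (x₀ := x₀) hx₀
  obtain ⟨t, ht, htΩ⟩ := hcomp.elim_nhds_subcover (fun x => Metric.ball x (R x))
    fun x hx => Metric.ball_mem_nhds x (hR x hx)
  obtain ⟨χ, hχ⟩ := SmoothPartitionOfUnity.exists_isSubordinate (modelWithCornersSelf ℝ (Rn n))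
    isClosed_closure (fun i : t => Metric.ball (i : Rn n) (R i)) (fun _ => Metric.isOpen_ball)
    (fun x hx => by simpa using htΩ hx)
  have hχd : ∀ i, ContDiff ℝ ∞ (χ i) := fun i => (χ i).contMDiff.contDiff
  have hχc : ∀ i, HasCompactSupport (χ i) := fun i =>
    Metric.isCompact_of_isClosed_isBounded (isClosed_tsupport _)
      (Metric.isBounded_ball.subset (hχ i))
  have hsum : φ = ∑ i, fun x => χ i x * φ x := by
    ext x
    rw [Finset.sum_apply, ← Finset.sum_mul]
    by_cases hx : x ∈ Ω
    · have := χ.sum_eq_one (subset_closure hx)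
      rw [finsum_eq_sum_of_fintype] at this
      rw [this, one_mul]
    · rw [hφΩ x hx, mul_zero]
  rw [hsum]
  have hL : ∀ i, MemLp (fun x => χ i x * φ x) 2 volume := fun i =>
    memLp_mul_of_continuous hφ (hχd i).continuous (hχc i)
  refine IsApproximable.sum _ (fun i => (hL i).1) fun i => ?_
  have hi : (i : Rn n) ∈ closure Ω := ht i i.2
  have hcpt : IsCompact (closure Ω ∩ tsupport (χ i)) := hcomp.inter_right (isClosed_tsupport _)
  refine isApproximable_of_translate (hL i)
    (memLp_fracGrad_mul hn hs0 hs1 hφ hφ' ((hχd i).of_le (by simp)) (hχc i)) hcpt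
    (fun x hx => ?_) (e i) (hδ i hi) (hS i hi _ hcpt (inter_subset_inter_right _ (hχ i)))
  by_contra h
  refine hx ⟨subset_closure (by_contra fun hxΩ => h ?_), subset_tsupport _ fun h0 => h ?_⟩
  · simp only [hφΩ x hxΩ, mul_zero]
  · simp only [h0, zero_mul]

/-! ### Limits of `L²` pairings -/

theorem tendsto_integral_inner {X E : Type*} [MeasurableSpace X] {μ : Measure X}
    [NormedAddCommGroup E] [InnerProductSpace ℝ E] {f g : X → E} {f' g' : ℕ → X → E}
    (hf : MemLp f 2 μ) (hg : MemLp g 2 μ) (hf' : ∀ k, MemLp (f' k) 2 μ)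
    (hg' : ∀ k, MemLp (g' k) 2 μ)
    (hff' : Tendsto (fun k => eLpNorm (f - f' k) 2 μ) atTop (𝓝 0))
    (hgg' : Tendsto (fun k => eLpNorm (g - g' k) 2 μ) atTop (𝓝 0)) :
    Tendsto (fun k => ∫ x, ⟪f' k x, g' k x⟫ ∂μ) atTop (𝓝 (∫ x, ⟪f x, g x⟫ ∂μ)) := by
  have key : ∀ {a b : X → E} (ha : MemLp a 2 μ) (hb : MemLp b 2 μ),
      ⟪ha.toLp a, hb.toLp b⟫ = ∫ x, ⟪a x, b x⟫ ∂μ := fun ha hb => by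
    rw [L2.inner_def]
    refine integral_congr_ae ?_
    filter_upwards [ha.coeFn_toLp, hb.coeFn_toLp] with x h1 h2
    rw [h1, h2]
  have lim : ∀ {a : X → E} {a' : ℕ → X → E} (ha : MemLp a 2 μ) (ha' : ∀ k, MemLp (a' k) 2 μ),
      Tendsto (fun k => eLpNorm (a - a' k) 2 μ) atTop (𝓝 0) →
      Tendsto (fun k => (ha' k).toLp (a' k)) atTop (𝓝 (ha.toLp a)) := fun ha ha' h => by
    rw [tendsto_iff_edist_tendsto_0]
    refine h.congr fun k => ?_
    rw [edist_comm, Lp.edist_toLp_toLp]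
  have := (lim hf hf' hff').inner (𝕜 := ℝ) (lim hg hg' hgg')
  simpa only [key] using this

theorem integrable_inner_of_memLp {X E : Type*} [MeasurableSpace X] {μ : Measure X}
    [NormedAddCommGroup E] [InnerProductSpace ℝ E] {f g : X → E} (hf : MemLp f 2 μ)
    (hg : MemLp g 2 μ) : Integrable (fun x => ⟪f x, g x⟫) μ := by
  refine (L2.integrable_inner (𝕜 := ℝ) (hf.toLp f) (hg.toLp g)).congr ?_
  filter_upwards [hf.coeFn_toLp, hg.coeFn_toLp] with x h1 h2
  rw [h1, h2]

theorem IsApproximable.exists_seq (h : IsApproximable s Ω φ) (hφ' : MemLp (fracGrad s φ) 2 volume) :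
    ∃ ψ : ℕ → Rn n → ℝ, (∀ k, IsTestFunction Ω (ψ k)) ∧
      (∀ k, MemLp (fracGrad s (ψ k)) 2 volume) ∧
      Tendsto (fun k => eLpNorm (φ - ψ k) 2 volume) atTop (𝓝 0) ∧
      Tendsto (fun k => eLpNorm (fracGrad s φ - fracGrad s (ψ k)) 2 volume) atTop (𝓝 0) := by
  have hne : ∀ k : ℕ, ((k : ℝ≥0∞) + 1)⁻¹ ≠ 0 := fun k =>
    ENNReal.inv_ne_zero.2 (ENNReal.add_ne_top.2 ⟨ENNReal.natCast_ne_top k, ENNReal.one_ne_top⟩)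
  have hlim : Tendsto (fun k : ℕ => ((k : ℝ≥0∞) + 1)⁻¹) atTop (𝓝 0) := by
    have := (tendsto_add_atTop_iff_nat 1).2 ENNReal.tendsto_inv_nat_nhds_zero
    exact this.congr fun k => by push_cast; rfl
  choose ψ h1 h2 h3 using fun k : ℕ => h _ (hne k)
  refine ⟨ψ, h1, fun k => ?_, tendsto_of_tendsto_of_tendsto_of_le_of_le tendsto_const_nhds hlim
    (fun _ => zero_le) h2, tendsto_of_tendsto_of_tendsto_of_le_of_le tendsto_const_nhds hlim
    (fun _ => zero_le) h3⟩
  have h4 : MemLp (fracGrad s φ - fracGrad s (ψ k)) 2 volume :=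
    ⟨hφ'.1.sub (aestronglyMeasurable_fracGrad s (h1 k).continuous.aestronglyMeasurable),
      (h3 k).trans_lt (ENNReal.inv_lt_top.2 (by positivity))⟩
  -- ∇ˢψ_k = ∇ˢφ − (∇ˢφ − ∇ˢψ_k), both terms in L².
  simpa using hφ'.sub h4

/-! ### Potentials -/

theorem MemHolderCompact.continuous (hs0 : 0 < s) (hA : MemHolderCompact s A) : Continuous A := by
  obtain ⟨C, hC⟩ := hA.1
  exact hC.continuous (Real.toNNReal_pos.2 hs0)

theorem continuous_symPart (hA : Continuous A) : Continuous (symPart A) := by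
  unfold symPart
  fun_prop

theorem hasCompactSupport_symPart (hA : HasCompactSupport A) : HasCompactSupport (symPart A) :=
  (hA.add (hA.comp_homeomorph (Homeomorph.prodComm _ _))).smul_left (f := fun _ => (2 : ℝ)⁻¹)

/-- B is bounded and vanishes unless y lies in a compact set, so |B(x,y)| ≤ |b(y)| with b in L², and
Tonelli separates the variables. -/
theorem exists_eLpNorm_smul_le (hB : Continuous B) (hBc : HasCompactSupport B) :
    ∃ C : ℝ≥0∞, C ≠ ⊤ ∧ ∀ f : Rn n → ℝ, AEStronglyMeasurable f volume →
      eLpNorm (fun z : Rn n × Rn n => f z.1 • B z) 2 volume ≤ C * eLpNorm f 2 volume := by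
  obtain ⟨M, hM⟩ := hBc.exists_bound_of_continuous hB
  let K : Set (Rn n) := Prod.snd '' tsupport B
  have hK : IsCompact K := hBc.isCompact.image continuous_snd
  have hKm : MeasurableSet K := hK.measurableSet
  let b : Rn n → ℝ := K.indicator fun _ => M
  have hb : MemLp b 2 volume :=
    memLp_indicator_const 2 hKm M (Or.inr hK.measure_lt_top.ne)
  have hBb : ∀ z, ‖B z‖ ≤ ‖b z.2‖ := fun z => by
    by_cases hz : z ∈ tsupport B
    · have : b z.2 = M := indicator_of_mem (mem_image_of_mem _ hz) _
      rw [this]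
      exact (hM z).trans (le_abs_self M)
    · rw [image_eq_zero_of_notMem_tsupport hz, norm_zero]
      exact norm_nonneg _
  refine ⟨eLpNorm b 2 volume, hb.2.ne, fun f hf => ?_⟩
  rw [← ENNReal.rpow_le_rpow_iff (zero_lt_two' ℝ), ENNReal.mul_rpow_of_nonneg _ _ zero_le_two,
    eLpNorm_two_rpow_two, eLpNorm_two_rpow_two, eLpNorm_two_rpow_two, mul_comm,
    ← lintegral_prod_mul (hf.enorm.pow_const _) (hb.1.enorm.pow_const _)]
  refine lintegral_mono fun z => ?_
  rw [enorm_smul, ENNReal.mul_rpow_of_nonneg _ _ zero_le_two]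
  gcongr
  exact enorm_le_iff_norm_le.2 (hBb z)

theorem memLp_smul_field (hB : Continuous B) (hBc : HasCompactSupport B) {f : Rn n → ℝ}
    (hf : MemLp f 2 volume) : MemLp (fun z : Rn n × Rn n => f z.1 • B z) 2 volume := by
  obtain ⟨C, hC, h⟩ := exists_eLpNorm_smul_le hB hBc
  exact ⟨hf.1.comp_fst.smul hB.aestronglyMeasurable,
    (h f hf.1).trans_lt (ENNReal.mul_lt_top hC.lt_top hf.2)⟩

theorem tendsto_smul_field (hB : Continuous B) (hBc : HasCompactSupport B) {f : Rn n → ℝ}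
    {f' : ℕ → Rn n → ℝ} (hf : MemLp f 2 volume) (hf' : ∀ k, MemLp (f' k) 2 volume)
    (h : Tendsto (fun k => eLpNorm (f - f' k) 2 volume) atTop (𝓝 0)) :
    Tendsto (fun k => eLpNorm ((fun z : Rn n × Rn n => f z.1 • B z) - fun z => f' k z.1 • B z)
      2 volume) atTop (𝓝 0) := by
  obtain ⟨C, hC, hle⟩ := exists_eLpNorm_smul_le hB hBc
  have h1 := ENNReal.Tendsto.const_mul (a := C) h (Or.inr hC)
  rw [mul_zero] at h1
  refine tendsto_of_tendsto_of_tendsto_of_le_of_le tendsto_const_nhds h1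
    (fun _ => zero_le) fun k => ?_
  refine (eLpNorm_congr_ae (.of_forall fun z => ?_)).trans_le (hle _ (hf.1.sub (hf' k).1))
  simp [sub_smul]

/-- ∇ˢ is directed along y − x, so pairings with it see only the parallel part of a field. -/
theorem inner_parPart (B : Rn n × Rn n → Rn n) (z : Rn n × Rn n) :
    ⟪parPart B z, z.2 - z.1⟫ = ⟪B z, z.2 - z.1⟫ := by
  unfold parPart
  split_ifs with h
  · rfl
  · have h1 : ‖z.1 - z.2‖ ^ 2 ≠ 0 := pow_ne_zero 2 (norm_ne_zero_iff.2 (sub_ne_zero.2 h))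
    rw [← neg_sub z.1 z.2, inner_neg_right, inner_neg_right, real_inner_smul_left,
      real_inner_self_eq_norm_sq, div_mul_cancel₀ _ h1]

theorem inner_parPart_fracGrad (B : Rn n × Rn n → Rn n) (u : Rn n → ℝ) (z : Rn n × Rn n) :
    ⟪parPart B z, fracGrad s u z⟫ = ⟪B z, fracGrad s u z⟫ := by
  simp only [fracGrad_eq, inner_smul_right, inner_parPart]

/-- The density whose integral is `⟨(∇·)^s A_s + ∫ |A|² dy, φ²⟩`. -/
def potDensity (s : ℝ) (A : Rn n × Rn n → Rn n) (φ : Rn n → ℝ) (z : Rn n × Rn n) : ℝ :=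
  2 * ⟪φ z.1 • symPart A z, fracGrad s φ z⟫ + ⟪φ z.1 • A z, φ z.1 • A z⟫

theorem integrable_inner_symPart (hA : Continuous A) (hAc : HasCompactSupport A)
    (hφ : MemLp φ 2 volume) (hφ' : MemLp (fracGrad s φ) 2 volume) :
    Integrable (fun z => ⟪φ z.1 • symPart A z, fracGrad s φ z⟫) volume :=
  integrable_inner_of_memLp (memLp_smul_field (continuous_symPart hA) (hasCompactSupport_symPart hAc) hφ) hφ'

theorem integrable_inner_field (hA : Continuous A) (hAc : HasCompactSupport A)
    (hφ : MemLp φ 2 volume) :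
    Integrable (fun z : Rn n × Rn n => ⟪φ z.1 • A z, φ z.1 • A z⟫) volume :=
  integrable_inner_of_memLp (memLp_smul_field hA hAc hφ) (memLp_smul_field hA hAc hφ)

theorem integrable_potDensity (hA : Continuous A) (hAc : HasCompactSupport A)
    (hφ : MemLp φ 2 volume) (hφ' : MemLp (fracGrad s φ) 2 volume) :
    Integrable (potDensity s A φ) volume :=
  ((integrable_inner_symPart hA hAc hφ hφ').const_mul 2).add (integrable_inner_field hA hAc hφ)

theorem integral_potDensity (hA : Continuous A) (hAc : HasCompactSupport A)
    (hφ : MemLp φ 2 volume) (hφ' : MemLp (fracGrad s φ) 2 volume) :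
    ∫ z, potDensity s A φ z = 2 * (∫ z, ⟪φ z.1 • symPart A z, fracGrad s φ z⟫) +
      ∫ z : Rn n × Rn n, ⟪φ z.1 • A z, φ z.1 • A z⟫ := by
  rw [← integral_const_mul]
  exact integral_add ((integrable_inner_symPart hA hAc hφ hφ').const_mul 2)
    (integrable_inner_field hA hAc hφ)

theorem symPart_swap (A : Rn n × Rn n → Rn n) (z : Rn n × Rn n) :
    symPart A z.swap = symPart A z := by
  rw [symPart, symPart, Prod.swap_swap, add_comm]

theorem integral_comp_swap {E : Type*} [NormedAddCommGroup E] [NormedSpace ℝ E]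
    (f : Rn n × Rn n → E) : ∫ z : Rn n × Rn n, f z.swap = ∫ z, f z :=
  measurePreserving_prod_swap.integral_comp MeasurableEquiv.prodComm.measurableEmbedding f

/-- The product rule for φ² gives the coefficients φ(x) and φ(y); as A_s and ∇ˢφ are swap invariant,
both terms have the same integral. -/
theorem fracDiv_sq (hA : Continuous A) (hAc : HasCompactSupport A)
    (hφ : MemLp φ 2 volume) (hφ' : MemLp (fracGrad s φ) 2 volume) :
    fracDiv s (parPart (symPart A)) (fun x => φ x * φ x) =
      2 * ∫ z, ⟪φ z.1 • symPart A z, fracGrad s φ z⟫ := by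
  have hi := integrable_inner_symPart hA hAc hφ hφ'
  have hi' : Integrable (fun z : Rn n × Rn n =>
      ⟪φ z.swap.1 • symPart A z.swap, fracGrad s φ z.swap⟫) volume :=
    measurePreserving_prod_swap.integrable_comp_of_integrable hi
  have h1 := integral_comp_swap fun z => ⟪φ z.1 • symPart A z, fracGrad s φ z⟫
  rw [two_mul]
  nth_rw 2 [← h1]
  rw [fracDiv, ← integral_add hi hi']
  refine integral_congr_ae (.of_forall fun z => ?_)
  simp only [inner_parPart_fracGrad, fracGrad_mul, symPart_swap, fracGrad_swap, Prod.fst_swap,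
    inner_add_right, inner_smul_right, real_inner_smul_left]

/-- The hypothesis on the potential is tested with ψ², which is again a nonnegative test function.
-/
theorem IsTestFunction.integral_potDensity_nonneg (hA : Continuous A) (hAc : HasCompactSupport A)
    (hApot : EffectivePotentialNonneg s Ω A) (hψ : IsTestFunction Ω ψ)
    (hψ' : MemLp (fracGrad s ψ) 2 volume) : 0 ≤ ∫ z, potDensity s A ψ z := by
  have h1 : IsTestFunction Ω fun x => ψ x * ψ x :=
    ⟨hψ.contDiff.mul hψ.contDiff, hψ.hasCompactSupport.mul_left,
      (tsupport_mul_subset_left).trans hψ.tsupport_subset⟩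
  have h2 := hApot _ h1 fun x => mul_self_nonneg _
  rw [fracDiv_sq hA hAc hψ.memLp hψ'] at h2
  rw [integral_potDensity hA hAc hψ.memLp hψ']
  refine h2.trans_eq ?_
  congr 1
  rw [Measure.volume_eq_prod, integral_prod _ (integrable_inner_field hA hAc hψ.memLp)]
  refine integral_congr_ae (.of_forall fun x => ?_)
  simp only
  rw [← integral_mul_const]
  refine integral_congr_ae (.of_forall fun y => ?_)
  simp only [real_inner_self_eq_norm_sq, norm_smul, mul_pow, Real.norm_eq_abs, sq_abs]
  ring

theorem IsApproximable.integral_potDensity_nonneg (hA : Continuous A) (hAc : HasCompactSupport A)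
    (hApot : EffectivePotentialNonneg s Ω A) (h : IsApproximable s Ω φ) (hφ : MemLp φ 2 volume)
    (hφ' : MemLp (fracGrad s φ) 2 volume) : 0 ≤ ∫ z, potDensity s A φ z := by
  obtain ⟨ψ, h1, h2, h3, h4⟩ := h.exists_seq hφ'
  have hL := fun k => (h1 k).memLp
  have hSc := continuous_symPart hA
  have hSs := hasCompactSupport_symPart hAc
  have t1 := tendsto_integral_inner (memLp_smul_field hSc hSs hφ) hφ'
    (fun k => memLp_smul_field hSc hSs (hL k)) h2 (tendsto_smul_field hSc hSs hφ hL h3) h4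
  have t2 := tendsto_integral_inner (memLp_smul_field hA hAc hφ) (memLp_smul_field hA hAc hφ)
    (fun k => memLp_smul_field hA hAc (hL k)) (fun k => memLp_smul_field hA hAc (hL k))
    (tendsto_smul_field hA hAc hφ hL h3) (tendsto_smul_field hA hAc hφ hL h3)
  rw [integral_potDensity hA hAc hφ hφ']
  refine ge_of_tendsto' ((t1.const_mul 2).add t2) fun k => ?_
  rw [← integral_potDensity hA hAc (hL k) (h2 k)]
  exact (h1 k).integral_potDensity_nonneg hA hAc hApot (h2 k)

/-! ### The magnetic form -/

theorem inner_antisymPart_nonneg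
    (hAanti : ∀ x y : Rn n, 0 ≤ ⟪parPart (antisymPart A) (x, y), y - x⟫) (z : Rn n × Rn n) :
    ⟪A z.swap, z.2 - z.1⟫ ≤ ⟪A z, z.2 - z.1⟫ := by
  have h := hAanti z.1 z.2
  have h1 := inner_parPart (antisymPart A) z
  simp only [Prod.mk.eta] at h
  rw [h1, antisymPart, symPart, inner_sub_left, real_inner_smul_left, inner_add_left] at h
  linarith

/-- Put u = P − p at x and u = Q − q at y, with P, Q the positive and p, q the negative parts, so Pp
= Qq = 0. With D the weighted vector y − x, α = A(x,y)·D and α' = A(y,x)·D, the left side equals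
−2|D|²(Pq + Qp) − (α − α')((p − q)² + Pq + Qp), and α ≥ α' by the sign of A_a. The |A|² terms
cancel. -/
theorem inner_magGrad_add_swap_le
    (hAanti : ∀ x y : Rn n, 0 ≤ ⟪parPart (antisymPart A) (x, y), y - x⟫) {z : Rn n × Rn n}
    (h1 : φ z.1 = max (-u z.1) 0) (h2 : φ z.2 = max (-u z.2) 0) :
    ⟪magGrad s A u z, magGrad s A φ z⟫ + ⟪magGrad s A u z.swap, magGrad s A φ z.swap⟫ +
      2 * ⟪fracGrad s φ z, fracGrad s φ z⟫ + (potDensity s A φ z + potDensity s A φ z.swap) ≤ 0 := by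
  have hα : ⟪A z.swap, fracWeight s z • (z.2 - z.1)⟫ ≤ ⟪A z, fracWeight s z • (z.2 - z.1)⟫ := by
    rw [inner_smul_right, inner_smul_right]
    exact mul_le_mul_of_nonneg_left (inner_antisymPart_nonneg hAanti z) (fracWeight_nonneg s z)
  have hd : 0 ≤ ⟪fracWeight s z • (z.2 - z.1), fracWeight s z • (z.2 - z.1)⟫ :=
    real_inner_self_nonneg
  obtain ⟨P, hP, hPp, hPu⟩ : ∃ P, 0 ≤ P ∧ P * φ z.1 = 0 ∧ u z.1 = P - φ z.1 := by
    refine ⟨max (u z.1) 0, le_max_right _ _, ?_, ?_⟩ <;> rw [h1] <;>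
      rcases le_total (u z.1) 0 with h | h <;> simp [h]
  obtain ⟨Q, hQ, hQq, hQu⟩ : ∃ Q, 0 ≤ Q ∧ Q * φ z.2 = 0 ∧ u z.2 = Q - φ z.2 := by
    refine ⟨max (u z.2) 0, le_max_right _ _, ?_, ?_⟩ <;> rw [h2] <;>
      rcases le_total (u z.2) 0 with h | h <;> simp [h]
  have hp : 0 ≤ φ z.1 := h1 ▸ le_max_right _ _
  have hq : 0 ≤ φ z.2 := h2 ▸ le_max_right _ _
  simp only [magGrad, potDensity, fracGrad_swap, symPart_swap, Prod.fst_swap]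
  simp only [fracGrad_eq]
  simp only [symPart]
  generalize fracWeight s z • (z.2 - z.1) = D at *
  generalize A z.swap = A' at *
  generalize A z = A₀ at *
  generalize φ z.1 = p at *
  generalize φ z.2 = q at *
  rw [hPu, hQu]
  simp only [inner_add_left, inner_add_right, real_inner_smul_left, inner_smul_right]
  rw [real_inner_comm A₀ D, real_inner_comm A' D]
  generalize ⟪A₀, D⟫ = α at *
  generalize ⟪A', D⟫ = α' at *
  generalize ⟪D, D⟫ = d at *
  generalize ⟪A₀, A₀⟫ = N at *
  generalize ⟪A', A'⟫ = N' at *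
  have e1 : 0 ≤ (P * q + Q * p) * d := by positivity
  have e2 : 0 ≤ (α - α') * ((p - q) ^ 2 + (P * q + Q * p)) :=
    mul_nonneg (sub_nonneg.2 hα) (by positivity)
  linear_combination 2 * e1 + e2 + (2 * d + 2 * α + N) * hPp + (2 * d - 2 * α' + N') * hQq

/-! ### Weak solutions and their negative parts -/

theorem MemHs.memLp {X : Type*} [NormedAddCommGroup X] [InnerProductSpace ℝ X]
    [FiniteDimensional ℝ X] [MeasurableSpace X] [BorelSpace X] {v : X → ℝ} (hv : MemHs s v) :
    MemLp v 2 volume := by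
  obtain ⟨h, -⟩ := hv
  simpa using h.re

theorem MemHsOn.memLp (hu : MemHsOn s Ω u) : MemLp u 2 (volume.restrict Ω) := by
  obtain ⟨v, hv, huv⟩ := hu
  exact (memLp_congr_ae huv).2 (hv.memLp.restrict Ω)

theorem measurableSet_fst_or_snd (hΩ : MeasurableSet Ω) :
    MeasurableSet {z : Rn n × Rn n | z.1 ∈ Ω ∨ z.2 ∈ Ω} :=
  (measurable_fst hΩ).union (measurable_snd hΩ)

/-- The negative part of `u` in `Ω`, extended by zero. -/
def negPartOn (Ω : Set (Rn n)) (u : Rn n → ℝ) : Rn n → ℝ :=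
  Ω.indicator fun x => max (-u x) 0

theorem memLp_negPartOn (hΩ : MeasurableSet Ω) (hu : MemLp u 2 (volume.restrict Ω)) :
    MemLp (negPartOn Ω u) 2 volume :=
  (memLp_indicator_iff_restrict hΩ).2 hu.neg.pos_part

theorem measurableSet_exterior (Ω : Set (Rn n)) : MeasurableSet (exterior Ω) :=
  isClosed_closure.isOpen_compl.measurableSet

theorem ae_of_ae_interior_exterior (hΩ : IsBoundedLipschitzDomain Ω) {p : Rn n → Prop}
    (h1 : ∀ x ∈ Ω, p x) (h2 : ∀ᵐ x ∂volume.restrict (exterior Ω), p x) : ∀ᵐ x, p x := by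
  rw [ae_restrict_iff' (measurableSet_exterior Ω)] at h2
  filter_upwards [h2, measure_eq_zero_iff_ae_notMem.1 hΩ.volume_frontier] with x hx hx'
  by_cases hxΩ : x ∈ Ω
  · exact h1 x hxΩ
  · refine hx fun hxc => hx' ?_
    rw [hΩ.isOpen.frontier_eq]
    exact ⟨hxc, hxΩ⟩

theorem negPartOn_ae_eq (hΩ : IsBoundedLipschitzDomain Ω)
    (hu : ∀ᵐ x ∂volume.restrict (exterior Ω), 0 ≤ u x) :
    ∀ᵐ x, negPartOn Ω u x = max (-u x) 0 := by
  refine ae_of_ae_interior_exterior hΩ (fun x hx => indicator_of_mem hx _) ?_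
  filter_upwards [hu, ae_restrict_mem (measurableSet_exterior Ω)] with x hx hxe
  rw [negPartOn, indicator_of_notMem (fun h => hxe (subset_closure h)), max_eq_right]
  linarith

theorem abs_max_neg_sub_le (a b : ℝ) : |max (-a) 0 - max (-b) 0| ≤ |a - b| := by
  have := abs_max_sub_max_le_abs (-a) (-b) 0
  rwa [neg_sub_neg, abs_sub_comm b a] at this

/-- Taking negative parts is 1-Lipschitz, so |∇ˢφ| ≤ |∇ˢu| a.e.; and ∇ˢφ vanishes where neither
point lies in Ω. -/
theorem memLp_fracGrad_negPartOn (hΩ : IsBoundedLipschitzDomain Ω)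
    (hum : AEStronglyMeasurable u volume)
    (hu : MemLp (fracGrad s u) 2 (volume.restrict {z | z.1 ∈ Ω ∨ z.2 ∈ Ω}))
    (hue : ∀ᵐ x ∂volume.restrict (exterior Ω), 0 ≤ u x) :
    MemLp (fracGrad s (negPartOn Ω u)) 2 volume := by
  have hD := measurableSet_fst_or_snd hΩ.isOpen.measurableSet
  have hm : AEStronglyMeasurable (negPartOn Ω u) volume :=
    (hum.neg.sup aestronglyMeasurable_const).indicator hΩ.isOpen.measurableSet
  have h1 : fracGrad s (negPartOn Ω u) =
      {z : Rn n × Rn n | z.1 ∈ Ω ∨ z.2 ∈ Ω}.indicator (fracGrad s (negPartOn Ω u)) := by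
    symm
    refine indicator_eq_self.2 fun z hz => by_contra fun hzD => hz (fracGrad_of_eq ?_)
    simp only [mem_ofPred_eq, not_or] at hzD
    rw [negPartOn, indicator_of_notMem hzD.1, indicator_of_notMem hzD.2]
  rw [h1, memLp_indicator_iff_restrict hD]
  refine hu.mono (aestronglyMeasurable_fracGrad s hm).restrict (ae_restrict_of_ae ?_)
  filter_upwards [ae_prod_of_ae (negPartOn_ae_eq hΩ hue)] with z hz
  refine norm_fracGrad_mono ?_
  rw [hz.1, hz.2]
  exact abs_max_neg_sub_le _ _

theorem memLp_magGrad (hA : Continuous A) (hAc : HasCompactSupport A) (hφ : MemLp φ 2 volume)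
    (hφ' : MemLp (fracGrad s φ) 2 volume) : MemLp (magGrad s A φ) 2 volume :=
  hφ'.add (memLp_smul_field hA hAc hφ)

theorem magGrad_sub (s : ℝ) (A : Rn n × Rn n → Rn n) (u v : Rn n → ℝ) :
    magGrad s A u - magGrad s A v = (fracGrad s u - fracGrad s v) +
      ((fun z : Rn n × Rn n => u z.1 • A z) - fun z => v z.1 • A z) := by
  ext1 z
  simp only [magGrad, Pi.sub_apply, Pi.add_apply]
  abel

theorem magGrad_eq_zero {z : Rn n × Rn n} (h1 : φ z.1 = 0) (h2 : φ z.2 = 0) :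
    magGrad s A φ z = 0 := by
  rw [magGrad, fracGrad_of_eq (h1.trans h2.symm), h1, zero_smul, add_zero]

theorem magForm_eq_setIntegral (hφ : ∀ x ∉ Ω, φ x = 0) (u : Rn n → ℝ) :
    magForm s A u φ =
      ∫ z in {z : Rn n × Rn n | z.1 ∈ Ω ∨ z.2 ∈ Ω}, ⟪magGrad s A u z, magGrad s A φ z⟫ := by
  refine (setIntegral_eq_integral_of_forall_compl_eq_zero fun z hz => ?_).symm
  simp only [mem_ofPred_eq, not_or] at hz
  rw [magGrad_eq_zero (hφ _ hz.1) (hφ _ hz.2), inner_zero_right]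

/-- u is square integrable only on Ω. Off Ω it is a.e. bounded, because g is and ∂Ω is null, and a
bounded factor times the compactly supported A is in L². -/
theorem IsWeakSolution.memLp_magGrad (hu : IsWeakSolution s Ω A F g u)
    (hΩ : IsBoundedLipschitzDomain Ω) (hA : Continuous A) (hAc : HasCompactSupport A)
    (hg : MemLp g ∞ (volume.restrict (exterior Ω))) :
    MemLp (magGrad s A u) 2 (volume.restrict {z : Rn n × Rn n | z.1 ∈ Ω ∨ z.2 ∈ Ω}) := by
  have hm := hΩ.isOpen.measurableSet
  have h1 : MemLp (Ω.indicator u) 2 volume :=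
    (memLp_indicator_iff_restrict hm).2 hu.memHsOn.memLp
  obtain ⟨M, hM⟩ : ∃ M : ℝ, ∀ᵐ x, ‖Ωᶜ.indicator u x‖ ≤ M := by
    refine ⟨(eLpNormEssSup g (volume.restrict (exterior Ω))).toReal, ae_of_ae_interior_exterior hΩ ?_ ?_⟩
    · intro x hx
      rw [indicator_of_notMem (not_not.2 hx), norm_zero]
      exact ENNReal.toReal_nonneg
    · have hgM : eLpNormEssSup g (volume.restrict (exterior Ω)) ≠ ⊤ := by
        simpa only [eLpNorm_exponent_top] using hg.2.ne
      filter_upwards [hu.exterior_value, ae_le_eLpNormEssSup (f := g)] with x hx hx'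
      refine (norm_indicator_le_norm_self u x).trans ?_
      rw [hx, ← toReal_enorm]
      exact ENNReal.toReal_mono hgM hx'
  have h2 : MemLp (fun z : Rn n × Rn n => Ωᶜ.indicator u z.1 • A z) 2 volume :=
    memLp_bdd_smul (hA.memLp_of_hasCompactSupport hAc)
      (hu.aestronglyMeasurable.indicator hm.compl).comp_fst
      (Measure.quasiMeasurePreserving_fst.ae hM)
  have h3 := (memLp_smul_field hA hAc h1).add h2
  refine hu.finite_energy.add ((h3.ae_eq (.of_forall fun z => ?_)).restrict _)
  simp only [Pi.add_apply]
  rw [← add_smul, ← Pi.add_apply (Ω.indicator u), indicator_self_add_compl]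

theorem IsWeakSolution.magForm_eq (hu : IsWeakSolution s Ω A F g u)
    (hΩ : IsBoundedLipschitzDomain Ω) (hA : Continuous A) (hAc : HasCompactSupport A)
    (hF : MemLp F ∞ (volume.restrict Ω)) (hg : MemLp g ∞ (volume.restrict (exterior Ω)))
    (h : IsApproximable s Ω φ) (hφ : MemLp φ 2 volume) (hφ' : MemLp (fracGrad s φ) 2 volume)
    (hφΩ : ∀ x ∉ Ω, φ x = 0) : magForm s A u φ = ∫ x in Ω, F x * φ x := by
  obtain ⟨ψ, h1, h2, h3, h4⟩ := h.exists_seq hφ'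
  have hL := fun k => (h1 k).memLp
  have hψΩ : ∀ k, ∀ x ∉ Ω, ψ k x = 0 := fun k x hx =>
    image_eq_zero_of_notMem_tsupport fun hx' => hx ((h1 k).tsupport_subset hx')
  have hfin : IsFiniteMeasure (volume.restrict Ω) :=
    isFiniteMeasure_restrict.2 hΩ.isBounded.measure_lt_top.ne
  -- On the bounded set Ω, L^∞ embeds in L², so φ ↦ ∫ Fφ is L²-continuous.
  have hF2 : MemLp F 2 (volume.restrict Ω) := hF.mono_exponent le_top
  have hres : ∀ {X E : Type _} [MeasurableSpace X] [NormedAddCommGroup E] {μ : Measure X}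
      {S : Set X} {f : ℕ → X → E}, Tendsto (fun k => eLpNorm (f k) 2 μ) atTop (𝓝 0) →
      Tendsto (fun k => eLpNorm (f k) 2 (μ.restrict S)) atTop (𝓝 0) := fun h =>
    tendsto_of_tendsto_of_tendsto_of_le_of_le tendsto_const_nhds h (fun _ => zero_le)
      fun k => eLpNorm_mono_measure _ Measure.restrict_le_self
  have hmag : Tendsto (fun k => eLpNorm (magGrad s A φ - magGrad s A (ψ k)) 2 volume)
      atTop (𝓝 0) := by
    have h5 := h4.add (tendsto_smul_field hA hAc hφ hL h3)
    rw [add_zero] at h5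
    refine tendsto_of_tendsto_of_tendsto_of_le_of_le tendsto_const_nhds h5 (fun _ => zero_le)
      fun k => ?_
    simp only [magGrad_sub]
    exact eLpNorm_add_le (hφ'.sub (h2 k)).1
      ((memLp_smul_field hA hAc hφ).sub (memLp_smul_field hA hAc (hL k))).1 one_le_two
  have hzero : ∀ {X E : Type _} [MeasurableSpace X] [NormedAddCommGroup E] (μ : Measure X)
      (f : X → E), Tendsto (fun _ : ℕ => eLpNorm (f - f) 2 μ) atTop (𝓝 0) := fun μ f => by
    simp
  have t1 := tendsto_integral_inner (hu.memLp_magGrad hΩ hA hAc hg)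
    ((FMSE.memLp_magGrad hA hAc hφ hφ').restrict _)
    (fun _ => hu.memLp_magGrad hΩ hA hAc hg)
    (fun k => (FMSE.memLp_magGrad hA hAc (hL k) (h2 k)).restrict _) (hzero _ _) (hres hmag)
  have t2 := tendsto_integral_inner (hφ.restrict Ω) hF2 (fun k => (hL k).restrict Ω)
    (fun _ => hF2) (hres h3) (hzero _ _)
  rw [magForm_eq_setIntegral hφΩ]
  refine tendsto_nhds_unique t1 (t2.congr fun k => ?_)
  rw [← magForm_eq_setIntegral (hψΩ k), (h1 k |> hu.equation _)]
  rfl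

/-! ### Vanishing of the negative part -/

theorem fracGrad_ae_eq_zero_of_magForm_nonneg (hA : Continuous A) (hAc : HasCompactSupport A)
    (hAanti : ∀ x y : Rn n, 0 ≤ ⟪parPart (antisymPart A) (x, y), y - x⟫)
    (hφ : MemLp φ 2 volume) (hφ' : MemLp (fracGrad s φ) 2 volume)
    (hφu : ∀ᵐ x, φ x = max (-u x) 0)
    (hint : Integrable (fun z => ⟪magGrad s A u z, magGrad s A φ z⟫) volume)
    (hform : 0 ≤ magForm s A u φ) (hpot : 0 ≤ ∫ z, potDensity s A φ z) :
    fracGrad s φ =ᵐ[volume] 0 := by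
  have swap_int : ∀ {f : Rn n × Rn n → ℝ}, Integrable f volume →
      Integrable (fun z : Rn n × Rn n => f z.swap) volume := fun hf =>
    measurePreserving_prod_swap.integrable_comp_of_integrable hf
  have hE := integrable_inner_of_memLp hφ' hφ'
  have hP := integrable_potDensity hA hAc hφ hφ'
  have h1 := integral_mono_ae
    (((hint.add (swap_int hint)).add (hE.const_mul 2)).add (hP.add (swap_int hP)))
    (integrable_zero _ _ _)
    ((ae_prod_of_ae hφu).mono fun z hz => inner_magGrad_add_swap_le (s := s) hAanti hz.1 hz.2)
  -- Swapping preserves integrals, so the inequality becomes twice the sum of the form, the energy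
  -- of φ and the potential term, all nonnegative.
  rw [integral_add' ((hint.add (swap_int hint)).add (hE.const_mul 2)) (hP.add (swap_int hP)),
    integral_add' (hint.add (swap_int hint)) (hE.const_mul 2), integral_add' hint (swap_int hint),
    integral_add' hP (swap_int hP), integral_comp_swap,
    integral_comp_swap fun z => ⟪magGrad s A u z, magGrad s A φ z⟫, integral_const_mul] at h1
  simp only [Pi.zero_apply, integral_zero] at h1
  unfold magForm at hform
  have h2 : ∫ z, ⟪fracGrad s φ z, fracGrad s φ z⟫ = 0 :=
    le_antisymm (by linarith) (integral_nonneg fun _ => real_inner_self_nonneg)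
  rw [integral_eq_zero_iff_of_nonneg (fun _ => real_inner_self_nonneg) hE] at h2
  filter_upwards [h2] with z hz
  exact inner_self_eq_zero.1 hz

/-- By Fubini some y outside Ω satisfies φ(x) = φ(y) = 0 for a.e. x; such y exist because the
complement of a bounded set has positive measure. -/
theorem ae_eq_zero_of_fracGrad_ae_eq_zero (hn : 0 < n) (hs0 : 0 < s) (hs1 : s < 1)
    (hΩ : Bornology.IsBounded Ω) (h : fracGrad s φ =ᵐ[volume] 0) (hφΩ : ∀ x ∉ Ω, φ x = 0) :
    ∀ᵐ x, φ x = 0 := by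
  have : Nonempty (Fin n) := ⟨⟨0, hn⟩⟩
  have : Nontrivial (Rn n) := inferInstance
  have h1 : ∀ᵐ y : Rn n, ∀ᵐ x : Rn n, fracGrad s φ (y, x) = 0 :=
    Measure.ae_ae_of_ae_prod h
  have h2 : volume Ωᶜ ≠ 0 := fun h0 => by
    have h3 := measure_univ_le_add_compl (μ := (volume : Measure (Rn n))) Ω
    rw [h0, add_zero, measure_univ_of_isAddLeftInvariant] at h3
    exact (hΩ.measure_lt_top.trans_le h3).ne rfl
  obtain ⟨y, hy, hyΩ⟩ := ((frequently_ae_mem_iff.2 h2).and_eventually h1).exists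
  filter_upwards [hyΩ, measure_eq_zero_iff_ae_notMem.1 (measure_singleton y)] with x hx hxy
  have h3 := eq_of_fracGrad_eq_zero hn hs0 hs1 hx fun h => hxy h.symm
  rw [← hφΩ y hy]
  exact h3.symm

end FMSE

end

/-- Weak maximum principle for the fractional magnetic Schrödinger equation. -/
theorem mainTheorem3 (n : ℕ) (hn : 0 < n) (s : ℝ) (hs0 : 0 < s) (hs1 : s < 1)
    (Ω : Set (FMSE.Rn n)) (hΩ : FMSE.IsBoundedLipschitzDomain Ω)
    (A : FMSE.Rn n × FMSE.Rn n → FMSE.Rn n) (hA : FMSE.MemHolderCompact s A)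
    (hAsym : FMSE.MemHsDouble s (FMSE.parPart (FMSE.symPart A)))
    (hAanti : ∀ x y : FMSE.Rn n,
      0 ≤ ⟪FMSE.parPart (FMSE.antisymPart A) (x, y), y - x⟫)
    (hApot : FMSE.EffectivePotentialNonneg s Ω A)
    (F g u : FMSE.Rn n → ℝ)
    (hF : MemLp F ∞ (volume.restrict Ω))
    (hF0 : ∀ᵐ x ∂(volume.restrict Ω), 0 ≤ F x)
    (hg : MemLp g ∞ (volume.restrict (FMSE.exterior Ω)))
    (hg0 : ∀ᵐ x ∂(volume.restrict (FMSE.exterior Ω)), 0 ≤ g x)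
    (hu : FMSE.IsWeakSolution s Ω A F g u) :
    ∀ᵐ x ∂volume, 0 ≤ u x := by
  have hAc := hA.2
  replace hA := hA.continuous hs0
  have hue : ∀ᵐ x ∂volume.restrict (FMSE.exterior Ω), 0 ≤ u x := by
    filter_upwards [hu.exterior_value, hg0] with x h1 h2
    rwa [h1]
  have hφ := FMSE.memLp_negPartOn hΩ.isOpen.measurableSet hu.memHsOn.memLp
  have hφ' := FMSE.memLp_fracGrad_negPartOn hΩ hu.aestronglyMeasurable hu.finite_energy hue
  have hφΩ : ∀ x ∉ Ω, FMSE.negPartOn Ω u x = 0 := fun x hx => indicator_of_notMem hx _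
  have happ := hΩ.isApproximable hn hs0 hs1 hφ hφ' hφΩ
  have hφu := FMSE.negPartOn_ae_eq hΩ hue
  have hform : 0 ≤ FMSE.magForm s A u (FMSE.negPartOn Ω u) := by
    rw [hu.magForm_eq hΩ hA hAc hF hg happ hφ hφ' hφΩ]
    refine integral_nonneg_of_ae ?_
    filter_upwards [hF0] with x hx
    exact mul_nonneg hx (indicator_nonneg (fun _ _ => le_max_right _ _) x)
  -- ∇ˢ_A u is controlled only where x or y lies in Ω; elsewhere ∇ˢ_A φ is zero.
  have hint : Integrable
      (fun z => ⟪FMSE.magGrad s A u z, FMSE.magGrad s A (FMSE.negPartOn Ω u) z⟫) volume := by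
    have h1 : IntegrableOn
        (fun z => ⟪FMSE.magGrad s A u z, FMSE.magGrad s A (FMSE.negPartOn Ω u) z⟫)
        {z | z.1 ∈ Ω ∨ z.2 ∈ Ω} volume :=
      FMSE.integrable_inner_of_memLp (hu.memLp_magGrad hΩ hA hAc hg)
        ((FMSE.memLp_magGrad hA hAc hφ hφ').restrict _)
    refine h1.integrable_of_forall_notMem_eq_zero fun z hz => ?_
    simp only [mem_ofPred_eq, not_or] at hz
    rw [FMSE.magGrad_eq_zero (hφΩ _ hz.1) (hφΩ _ hz.2), inner_zero_right]
  have hzero := FMSE.ae_eq_zero_of_fracGrad_ae_eq_zero hn hs0 hs1 hΩ.isBounded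
    (FMSE.fracGrad_ae_eq_zero_of_magForm_nonneg hA hAc hAanti hφ hφ' hφu hint hform
      (happ.integral_potDensity_nonneg hA hAc hApot hφ hφ')) hφΩ
  filter_upwards [hφu, hzero] with x h1 h2
  have h3 : -u x ≤ max (-u x) 0 := le_max_left _ _
  linarith
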